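/- **Setting.** Let $f:\bigotimes_{i=1}^n\mathbb R^{m_i}\to\mathbb R$ be differentiable and, for $i=1,\dots,n$, let $h_i=(h_{i,1},\dots,h_{i,p_i}):\mathbb R^{m_i}\to\mathbb R^{p_i}$ have convex differentiable components. Put $S_i=\{w:h_i(w)\le 0\}$ and $F(z)=f(z)+\sum_i\delta_{S_i}(x_i)$ for $z=(x_1,\dots,x_n)$, where $\delta_{S_i}$ is $0$ on $S_i$ and $\infty$ elsewhere. Let $\bar\varepsilon>0$, $\tilde\rho\in(0,1)$, $\varepsilon^{(k)}=\bar\varepsilon\tilde\rho^{\,k}$, and $\bar S_i=\{w:\mathrm{dist}(w,S_i)\le\bar\varepsilon\}$. For an extended-valued $G$ and $x$ with $G(x)<\infty$, $\partial G(x)$ is the Fréchet subdifferential, i.e. the set of $u$ with $\liminf_{y\to x,\,y\ne x}\frac{G(y)-G(x)-\langle u,y-x\rangle}{\|y-x\|}\ge0$; $\partial G(x)=\emptyset$ if $G(x)=\infty$; $x$ is stationary if $0\in\partial G(x)$. A number $\theta\in[0,1)$ is a Łojasiewicz exponent of $G$ at $\bar x$ if there are $c,\eta>0$ with $|G(x)-G(\bar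 x)|^\theta\le c\,\mathrm{dist}(0,\partial G(x))$ whenever $\|x-\bar x\|\le\eta$ (with $0^0=0$ and $\mathrm{dist}(0,\emptyset)=\infty$). **Assumptions.** (1) There are $L_i>0$ with $\|\nabla_if(z_1)-\nabla_if(z_2)\|\le L_i\|z_1-z_2\|$ for all $z_1,z_2\in\bigotimes_j\bar S_j$; put $L=\max_iL_i$. Let $\gamma>1$, $M_l=\gamma L$ and $M_u\ge M_l$. (2) For each $i$, $S_i$ is nonempty, convex and compact; $h_i$ is linear (each component has the form $\langle a,\cdot\rangle+b$) or satisfies $h_i(\hat x_i)<0$ for some $\hat x_i$; and there is $\tilde c_i\ge0$ with $\mathrm{dist}(x_i,S_i)\le\tilde c_i\|\max\{h_i(x_i),0\}\|$ for all $x_i$ with $\mathrm{dist}(x_i,\bar S_i)\le\frac1{M_l}\sup_{z\in\bigotimes_j\bar S_j}\|\nabla_if(z)\|$. (3) $F$ has a Łojasiewicz exponent at each of its stationary points. **Iterates.** Let $z^{(k)}=(x_i^{(k)})_{i=1}^n$ and $\sigma_i^{(k)}\in[M_l,M_u]$, $k\ge0$, be such that for all $k\ge0$ and all $i$ there is $\lambda\in\mathbb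 R_+^{p_i}$ with $\sqrt{r_i(x_i^{(k+1)},\lambda,\tilde x_i^{(k)})}\le\varepsilon^{(k)}$, where $\tilde x_i^{(k)}=x_i^{(k)}-\frac1{\sigma_i^{(k)}}\nabla_if(x_{<i}^{(k+1)},x_{\ge i}^{(k)})$ and $$r_i(x,\lambda,\tilde x)=\max\{\langle x,x-\tilde x+\nabla h_i(x)\lambda\rangle,0\}+\|x-\tilde x+\nabla h_i(x)\lambda\|_\infty+\|\max\{h_i(x),0\}\|_\infty+\max\{-\langle\lambda,h_i(x)\rangle,0\},$$ with $\nabla h_i(x)\lambda=\sum_j\lambda_j\nabla h_{i,j}(x)$. Let $\bar z^{(k+1)}$ be the point whose $i$-th block is the minimizer over $x_i\in S_i$ of $\langle\nabla_if(x_{<i}^{(k+1)},x_{\ge i}^{(k)}),x_i-x_i^{(k)}\rangle+\frac{\sigma_i^{(k)}}2\|x_i-x_i^{(k)}\|^2$. With $\nu=\frac{12}{\gamma-1}$, put, for $k\ge1$, $$C_1^{(k)}=\tfrac12\Big(\max_i\sigma_i^{(k)}+L\big[\tfrac\nu2n^2+(2+\tfrac2\nu-\tfrac\nu2)n+2\nu+\tfrac4\nu+3\big]\Big),\quad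 u^{(k)}=\sum_{t\ge k}C_1^{(t)}\|\bar z^{(t)}-z^{(t)}\|^2,\quad v^{(k)}=F(\bar z^{(k)})+u^{(k)}+u^{(k+1)}.$$ **Theorem.** The sequence $z^{(k)}$ converges to a stationary point $\bar z$ of $F$, the series defining $u^{(k)}$ converge, and $v^{(k)}$ converges to a real number $\underline F$. Suppose moreover that $v^{(k)}>\underline F$ for all $k\ge1$, and let $\theta\in[0,1)$ be a Łojasiewicz exponent of $F$ at $\bar z$. (i) If $\theta=0$, then there is $\rho_1\in(0,1)$ with $\|z^{(k)}-\bar z\|=O(\rho_1^k)$ as $k\to\infty$. (ii) If $\theta\in(0,\frac12]$, then there is $\rho_2\in(0,1)$ with $\|z^{(k)}-\bar z\|=O(\rho_2^k)$ as $k\to\infty$. (iii) If $\theta\in(\frac12,1)$, then $\|z^{(k)}-\bar z\|=O\big(k^{-\frac{1-\theta}{2\theta-1}}\big)$ as $k\to\infty$. -/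

import Mathlib

open Filter Topology Asymptotics
open scoped ENNReal

noncomputable section

namespace PALMI

/-- A single variable block `ℝ^d` with its Euclidean structure. -/
abbrev Block (d : ℕ) : Type := EuclideanSpace ℝ (Fin d)

/-- The product `⊗ᵢ ℝ^{mᵢ}` with the Euclidean norm and inner product of the product. -/
abbrev Space {n : ℕ} (m : Fin n → ℕ) : Type := PiLp 2 (fun i : Fin n => Block (m i))

section Subdifferential

variable {E : Type*} [NormedAddCommGroup E] [InnerProductSpace ℝ E]

/-- The Fréchet subdifferential of an extended-valued function; empty off the domain. -/
def frechetSubdiff (G : E → EReal) (x : E) : Set E :=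
  {u | G x < ⊤ ∧
    0 ≤ liminf (fun y : E => (G y - G x - ((inner ℝ u (y - x) : ℝ) : EReal)) / ((‖y - x‖ : ℝ) : EReal))
      (𝓝[≠] x)}

/-- `x` is a stationary point of `G`: `0 ∈ ∂G(x)`. -/
def IsStationaryPt (G : E → EReal) (x : E) : Prop := (0 : E) ∈ frechetSubdiff G x

/-- `a ^ θ` with the convention `0 ^ 0 = 0`. -/
def lojPow (a : ℝ≥0∞) (θ : ℝ) : ℝ≥0∞ := if a = 0 then 0 else a ^ θ

/-- `θ` is a Łojasiewicz exponent of `G` at `xbar`: `0 ≤ θ < 1` and there are `c, η > 0` with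
`|G(x) - G(xbar)|^θ ≤ c · dist(0, ∂G(x))` on the closed ball of radius `η` about `xbar`
(the distance to the empty set is `∞`). -/
def IsLojasiewiczExponent (G : E → EReal) (xbar : E) (θ : ℝ) : Prop :=
  0 ≤ θ ∧ θ < 1 ∧ ∃ c > (0 : ℝ), ∃ η > (0 : ℝ), ∀ x ∈ Metric.closedBall xbar η,
    lojPow (G x - G xbar).abs θ ≤ ENNReal.ofReal c * Metric.infEDist (0 : E) (frechetSubdiff G x)

/-- The Łojasiewicz property of `G` at `xbar`. -/
def HasLojasiewicz (G : E → EReal) (xbar : E) : Prop := ∃ θ : ℝ, IsLojasiewiczExponent G xbar θ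

/-- The indicator function of a set, `0` on the set and `∞` off it. -/
def indicatorFun {X : Type*} (S : Set X) (x : X) : EReal :=
  open Classical in if x ∈ S then 0 else ⊤

end Subdifferential

/-- The data `f, h` of the block-structured problem
`min f(x₁,…,xₙ)` subject to `hᵢ(xᵢ) ≤ 0`, with `f` differentiable and every component
`h_{i,j}` convex and differentiable. -/
structure BlockProblem {n : ℕ} (m p : Fin n → ℕ) where
  f : Space m → ℝ
  h : (i : Fin n) → Fin (p i) → Block (m i) → ℝ
  f_differentiable : Differentiable ℝ f
  h_convex : ∀ i j, ConvexOn ℝ Set.univ (h i j)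
  h_differentiable : ∀ i j, Differentiable ℝ (h i j)

namespace BlockProblem

variable {n : ℕ} {m p : Fin n → ℕ} (P : BlockProblem m p)

/-- The feasible set `Sᵢ` of block `i`. -/
def feas (i : Fin n) : Set (Block (m i)) := {w | ∀ j, P.h i j w ≤ 0}

/-- The extended-valued objective `F = f + ∑ᵢ δ_{Sᵢ}`. -/
def F (z : Space m) : EReal := (P.f z : EReal) + ∑ i, indicatorFun (P.feas i) (z i)

/-- The partial gradient `∇ᵢ f(z)`. -/
def partialGrad (i : Fin n) (z : Space m) : Block (m i) := (gradient P.f z) i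

/-- The enlarged set of all points at distance at most `εbar` from `Sᵢ`. -/
def enlarged (εbar : ℝ) (i : Fin n) : Set (Block (m i)) := {w | Metric.infDist w (P.feas i) ≤ εbar}

/-- The product of the enlarged sets. -/
def enlargedProd (εbar : ℝ) : Set (Space m) := {z | ∀ i, z i ∈ P.enlarged εbar i}

/-- Block-wise Lipschitz continuity of the gradient over the enlarged product, moduli `Lᵢ > 0`. -/
def LipschitzBlocks (εbar : ℝ) (Lip : Fin n → ℝ) : Prop :=
  ∀ i, 0 < Lip i ∧ ∀ z₁ ∈ P.enlargedProd εbar, ∀ z₂ ∈ P.enlargedProd εbar,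
    ‖P.partialGrad i z₁ - P.partialGrad i z₂‖ ≤ Lip i * ‖z₁ - z₂‖

/-- `sup ‖∇ᵢ f‖` over the enlarged product. -/
def gradBound (εbar : ℝ) (i : Fin n) : ℝ :=
  sSup ((fun z => ‖P.partialGrad i z‖) '' P.enlargedProd εbar)

/-- `hᵢ` is linear, in the sense of linear constraints: every component is `⟨a, ·⟩ + b`. -/
def IsLinear (i : Fin n) : Prop :=
  ∀ j, ∃ (a : Block (m i)) (b : ℝ), ∀ x, P.h i j x = inner ℝ a x + b

/-- The Slater constraint qualification for `hᵢ`. -/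
def Slater (i : Fin n) : Prop := ∃ x, ∀ j, P.h i j x < 0

/-- The Hoffman-like error bound for `hᵢ`, with the Euclidean norm of `max{hᵢ(x), 0}`, over the
points whose distance to the enlarged set is at most `sup ‖∇ᵢ f‖ / Ml`. -/
def HoffmanBound (εbar Ml : ℝ) (i : Fin n) : Prop :=
  ∃ c : ℝ, 0 ≤ c ∧ ∀ x : Block (m i),
    Metric.infDist x (P.enlarged εbar i) ≤ P.gradBound εbar i / Ml →
      Metric.infDist x (P.feas i) ≤
        c * ‖(WithLp.toLp 2 (fun j => max (P.h i j x) 0) : EuclideanSpace ℝ (Fin (p i)))‖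

/-- The assumptions on the feasible sets and constraint functions. -/
def ConstraintAssumption (εbar Ml : ℝ) : Prop :=
  ∀ i, (P.feas i).Nonempty ∧ Convex ℝ (P.feas i) ∧ IsCompact (P.feas i) ∧
    (P.IsLinear i ∨ P.Slater i) ∧ P.HoffmanBound εbar Ml i

/-- `∇hᵢ(x) λ`. -/
def jacMul (i : Fin n) (x : Block (m i)) (lam : Fin (p i) → ℝ) : Block (m i) :=
  ∑ j, lam j • gradient (P.h i j) x

/-- The residual `rᵢ(x, λ, x̃)`. The second and third terms are sup norms, since `Fin d → ℝ`
carries the sup norm. -/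
def residual (i : Fin n) (x : Block (m i)) (lam : Fin (p i) → ℝ) (xt : Block (m i)) : ℝ :=
  max (inner ℝ x (x - xt + P.jacMul i x lam)) 0
    + ‖WithLp.ofLp (x - xt + P.jacMul i x lam)‖
    + ‖fun j => max (P.h i j x) 0‖
    + max (-(∑ j, lam j * P.h i j x)) 0

/-- The point `(x_{<i}^{(k+1)}, x_{≥i}^{(k)})`. -/
def mixed (z : ℕ → Space m) (k : ℕ) (i : Fin n) : Space m :=
  WithLp.toLp 2 (fun j => if j < i then z (k + 1) j else z k j)

/-- `x̃ᵢ^{(k)} = xᵢ^{(k)} - ∇ᵢ f(x_{<i}^{(k+1)}, x_{≥i}^{(k)}) / σᵢ^{(k)}`. -/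
def gradStep (z : ℕ → Space m) (σ : ℕ → Fin n → ℝ) (k : ℕ) (i : Fin n) : Block (m i) :=
  z k i - (1 / σ k i) • P.partialGrad i (mixed z k i)

/-- The objective of the `i`-th proximal linearized subproblem at iteration `k`. -/
def subObj (z : ℕ → Space m) (σ : ℕ → Fin n → ℝ) (k : ℕ) (i : Fin n) (x : Block (m i)) : ℝ :=
  inner ℝ (P.partialGrad i (mixed z k i)) (x - z k i) + σ k i / 2 * ‖x - z k i‖ ^ 2

/-- `(z, σ)` is generated by the infeasible inexact proximal alternating linearized minimization
method with tolerances `ε` and proximal parameters in `[Ml, Mu]`. -/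
structure IsRun (ε : ℕ → ℝ) (Ml Mu : ℝ) (z : ℕ → Space m) (σ : ℕ → Fin n → ℝ) : Prop where
  prox_mem : ∀ k i, σ k i ∈ Set.Icc Ml Mu
  inexact : ∀ k i, ∃ lam : Fin (p i) → ℝ, (∀ j, 0 ≤ lam j) ∧
    √(P.residual i (z (k + 1) i) lam (P.gradStep z σ k i)) ≤ ε k

/-- A minimizer of `g` over `S` (meaningful when one exists). -/
def argminOn {d : ℕ} (g : Block d → ℝ) (S : Set (Block d)) : Block d :=
  Classical.epsilon (fun x => x ∈ S ∧ IsMinOn g S x)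

/-- The exact iterates `zbar^{(k+1)}`, whose `i`-th block is the solution of the `i`-th subproblem
at iteration `k`. They exist for indices `≥ 1`; the value at index `0` is a placeholder. -/
def exactIter (z : ℕ → Space m) (σ : ℕ → Fin n → ℝ) : ℕ → Space m
  | 0 => z 0
  | k + 1 => WithLp.toLp 2 (fun i => argminOn (P.subObj z σ k i) (P.feas i))

/-- The constant `C₁^{(k)}`, where `ν = 12 / (γ - 1)` and `s = maxᵢ σᵢ^{(k)}`. -/
def constC1 (n : ℕ) (L γ s : ℝ) : ℝ :=
  let ν : ℝ := 12 / (γ - 1)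
  (s + L * (ν / 2 * (n : ℝ) ^ 2 + (2 + 2 / ν - ν / 2) * n + 2 * ν + 4 / ν + 3)) / 2

/-- The `t`-th error term `C₁^{(t)} ‖zbar^{(t)} - z^{(t)}‖²`. -/
def errTerm (L γ : ℝ) (z : ℕ → Space m) (σ : ℕ → Fin n → ℝ) (t : ℕ) : ℝ :=
  constC1 n L γ (⨆ i, σ t i) * ‖P.exactIter z σ t - z t‖ ^ 2

/-- `u^{(k)} = ∑_{t ≥ k} C₁^{(t)} ‖zbar^{(t)} - z^{(t)}‖²`. -/
def errTail (L γ : ℝ) (z : ℕ → Space m) (σ : ℕ → Fin n → ℝ) (k : ℕ) : ℝ :=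
  ∑' t, P.errTerm L γ z σ (k + t)

/-- The surrogate value `v^{(k)} = F(zbar^{(k)}) + u^{(k)} + u^{(k+1)}`, for `k ≥ 1`. -/
def surrogate (L γ : ℝ) (z : ℕ → Space m) (σ : ℕ → Fin n → ℝ) (k : ℕ) : EReal :=
  P.F (P.exactIter z σ k)
    + ((P.errTail L γ z σ k + P.errTail L γ z σ (k + 1) : ℝ) : EReal)

end BlockProblem

end PALMI

end

open PALMI

/-! Everything is compared with the exact iterates `w k` (the points z̄⁽ᵏ⁾), which are feasible for
`k ≥ 1`. The stopping test bounds the residual by ε_k². Convexity of the constraints and the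
Hoffman-like bound turn this into ‖z_k - w_k‖ = O(ρ^k) (`norm_sub_sq_le_residual`,
`exists_infDist_le_of_hoffman`, `exists_error_le`). So `w` behaves like an exact proximal linearized
scheme with geometrically small errors: `f` decreases by a multiple of ‖w_{k+1} - w_k‖² up to
O(ρ^{2k}) (`exists_descent`), and `F` has a subgradient at w_{k+1} of size O(‖w_{k+1} - w_k‖ + ρ^k)
(`exists_subgradient`).

The errors are absorbed by a change of potential. Put R_k = f(w_k) - Fbar + D ρ^{2k} and b_k =
‖w_{k+1} - w_k‖ + ρ^k. For suitable D the decrease of D ρ^{2k} pays for the error, so α b_k² ≤ R_k -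
R_{k+1} and R_k > 0 eventually hold with no error term (`exists_potential`). The Łojasiewicz
inequality is used with ϑ = max θ (1/2): since the gaps are at most 1, this is weaker than the
original, and ϑ ≥ 1/2 gives (ρ^{2k})^ϑ ≤ ρ^k, so R_{k+1}^ϑ ≤ C b_k near the limit.

From there the standard Kurdyka–Łojasiewicz argument applies (`tendsto_of_kl`). Concavity of t ↦
t^{1-ϑ} makes the step lengths telescope, which traps `w` near a stationary cluster point and gives
‖w_{k+1} - x‖ = O(R_k^{1-ϑ}). Squaring the inequality gives R_{k+1}^{2ϑ} ≤ C (R_k - R_{k+1}):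
geometric decay if ϑ = 1/2, which covers (i) and (ii), and R_k = O(k^{-1/(2θ-1)}) otherwise. -/

namespace PALMI

/-! ### Kurdyka–Łojasiewicz convergence and scalar rate recursions. -/

section Sequences

/-- The tangent inequality for the concave function `x ↦ x ^ p`, `0 ≤ p ≤ 1`. -/
theorem rpow_le_tangent {x y p : ℝ} (hx : 0 < x) (hy : 0 < y) (h0 : 0 ≤ p) (h1 : p ≤ 1) :
    x ^ p ≤ y ^ p + p * y ^ (p - 1) * (x - y) := by
  have h := rpow_one_add_le_one_add_mul_self (s := x / y - 1)
    (by have := (div_pos hx hy).le; linarith) h0 h1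
  have e : 1 + (x / y - 1) = x / y := by ring
  rw [e, Real.div_rpow hx.le hy.le, div_le_iff₀ (Real.rpow_pos_of_pos hy p)] at h
  refine h.trans (le_of_eq ?_)
  rw [Real.rpow_sub_one hy.ne']
  field_simp

/-- One step of the Kurdyka–Łojasiewicz argument: sufficient decrease together with the
Łojasiewicz inequality bounds the step length by a telescoping quantity. -/
theorem kl_step {r r' b b' α C θ : ℝ} (hr : 0 < r) (hr' : 0 < r') (hα : 0 < α)
    (hC : 0 < C) (hθ0 : 0 ≤ θ) (hθ : θ < 1) (hb' : 0 ≤ b')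
    (hd : α * b ^ 2 ≤ r - r') (hkl : r ^ θ ≤ C * b') :
    2 * b ≤ b' + C / ((1 - θ) * α) * (r ^ (1 - θ) - r' ^ (1 - θ)) := by
  have hθ' : 0 < 1 - θ := by linarith
  have hrθ : 0 < r ^ θ := Real.rpow_pos_of_pos hr θ
  have ht := rpow_le_tangent hr' hr hθ'.le (by linarith : 1 - θ ≤ 1)
  have e : r ^ (1 - θ - 1) = (r ^ θ)⁻¹ := by
    rw [← Real.rpow_neg hr.le]; congr 1; ring
  rw [e] at ht
  set X := r ^ (1 - θ) - r' ^ (1 - θ) with hX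
  have h1 : (1 - θ) * (r - r') ≤ r ^ θ * X := by
    have : (1 - θ) * (r ^ θ)⁻¹ * (r - r') ≤ X := by rw [hX]; linarith
    calc (1 - θ) * (r - r') = r ^ θ * ((1 - θ) * (r ^ θ)⁻¹ * (r - r')) := by
          field_simp
      _ ≤ r ^ θ * X := by gcongr
  have hrr : 0 ≤ r - r' := le_trans (by positivity) hd
  have hX0 : 0 ≤ X := by
    have : 0 ≤ r ^ θ * X := le_trans (by positivity) h1
    exact nonneg_of_mul_nonneg_right this hrθ
  have h2 : (1 - θ) * (α * b ^ 2) ≤ C * b' * X :=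
    (mul_le_mul_of_nonneg_left hd hθ'.le).trans
      (h1.trans (mul_le_mul_of_nonneg_right hkl hX0))
  set Y := C / ((1 - θ) * α) * X with hY
  have hY0 : 0 ≤ Y := by positivity
  have h3 : b ^ 2 ≤ b' * Y := by
    have e : b' * Y = (C * b' * X) / ((1 - θ) * α) := by rw [hY]; ring
    rw [e, le_div_iff₀ (by positivity)]
    linarith
  -- Arithmetic–geometric mean: 4 b' Y ≤ (b' + Y)². This is the source of the factor 2 on the left
  -- of the conclusion.
  have h4 : (2 * b) ^ 2 ≤ (b' + Y) ^ 2 := by nlinarith [sq_nonneg (b' - Y)]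
  exact abs_le_of_sq_le_sq h4 (by positivity) |> le_of_abs_le

variable {X : Type*} [PseudoMetricSpace X]

/-- Telescoping the Kurdyka–Łojasiewicz steps. -/
theorem dist_le_of_kl {w : ℕ → X} {R b : ℕ → ℝ} {α C θ : ℝ} (hα : 0 < α) (hC : 0 < C)
    (hθ0 : 0 ≤ θ) (hθ : θ < 1) (k : ℕ) (hR : ∀ j, k ≤ j → 0 < R j)
    (hb : ∀ j, k ≤ j → dist (w j) (w (j + 1)) ≤ b j)
    (hd : ∀ j, k ≤ j → α * b j ^ 2 ≤ R j - R (j + 1)) (n : ℕ)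
    (hkl : ∀ j, j < n → dist (w (k + 1)) (w (k + 1 + j)) ≤
        b k + C / ((1 - θ) * α) * R (k + 1) ^ (1 - θ) → R (k + j + 1) ^ θ ≤ C * b (k + j)) :
    dist (w (k + 1)) (w (k + 1 + n)) ≤ b k + C / ((1 - θ) * α) * R (k + 1) ^ (1 - θ) := by
  set M := C / ((1 - θ) * α) with hM
  have hθ' : 0 < 1 - θ := by linarith
  have hM0 : 0 ≤ M := by positivity
  have hb0 : ∀ j, k ≤ j → 0 ≤ b j := fun j hj => dist_nonneg.trans (hb j hj)
  -- Of the two copies of `b` bounded by `kl_step`, one pays for the distance travelled; the other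
  -- stays on the left and cancels the `b'` of the next step.
  have key : ∀ i, i ≤ n → dist (w (k + 1)) (w (k + 1 + i)) + b (k + i) ≤
      b k + M * (R (k + 1) ^ (1 - θ) - R (k + 1 + i) ^ (1 - θ)) := by
    intro i
    induction i with
    | zero => intro _; simp
    | succ i ih =>
      intro hi
      have ih := ih (by omega)
      have hp : 0 ≤ M * R (k + 1 + i) ^ (1 - θ) :=
        mul_nonneg hM0 (Real.rpow_nonneg (hR _ (by omega)).le _)
      -- The Łojasiewicz inequality is available only while the path stays close, and the induction
      -- hypothesis supplies exactly that premise.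
      have hk := hkl i (by omega) (by have := hb0 (k + i) (by omega); linarith)
      have hst := kl_step (hR (k + i + 1) (by omega)) (hR (k + i + 1 + 1) (by omega)) hα hC hθ0 hθ
        (hb0 (k + i) (by omega)) (hd (k + i + 1) (by omega)) hk
      rw [← hM] at hst
      have e1 : k + 1 + i = k + i + 1 := by omega
      have e2 : k + 1 + (i + 1) = k + i + 1 + 1 := by omega
      have e3 : k + (i + 1) = k + i + 1 := by omega
      have ht := dist_triangle (w (k + 1)) (w (k + i + 1)) (w (k + i + 1 + 1))
      have hbb := hb (k + i + 1) (by omega)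
      rw [e1] at ih
      rw [e2, e3]
      linarith
  have h := key n le_rfl
  have hp : 0 ≤ M * R (k + 1 + n) ^ (1 - θ) :=
    mul_nonneg hM0 (Real.rpow_nonneg (hR _ (by omega)).le _)
  have := hb0 (k + n) (by omega)
  linarith

/-- Convergence of a sequence with sufficient decrease that satisfies the Łojasiewicz inequality
around a cluster point, with a bound on the distance to the limit. -/
theorem tendsto_of_kl {w : ℕ → X} {R b : ℕ → ℝ} {x : X} {α C θ η : ℝ} (hα : 0 < α) (hC : 0 < C)
    (hθ0 : 1 / 2 ≤ θ) (hθ : θ < 1) (hη : 0 < η) (hR : ∀ᶠ j in atTop, 0 < R j)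
    (hR0 : Tendsto R atTop (𝓝 0))
    (hb : ∀ᶠ j in atTop, dist (w j) (w (j + 1)) ≤ b j)
    (hd : ∀ᶠ j in atTop, α * b j ^ 2 ≤ R j - R (j + 1))
    (hcl : MapClusterPt x atTop w)
    (hkl : ∀ᶠ j in atTop, dist (w (j + 1)) x ≤ η → R (j + 1) ^ θ ≤ C * b j) :
    Tendsto w atTop (𝓝 x) ∧
    (∃ M, ∀ᶠ k in atTop, dist (w (k + 1)) x ≤ M * R k ^ (1 - θ)) ∧
    ∀ᶠ k in atTop, R (k + 1) ^ (2 * θ) ≤ C ^ 2 / α * (R k - R (k + 1)) := by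
  set M := C / ((1 - θ) * α) with hM
  have hθ' : 0 < 1 - θ := by linarith
  have hM0 : 0 ≤ M := by positivity
  obtain ⟨K, hK⟩ := eventually_atTop.1 (hR.and (hb.and (hd.and hkl)))
  have hb0 : ∀ j, K ≤ j → 0 ≤ b j := fun j hj => dist_nonneg.trans (hK j hj).2.1
  have hanti : ∀ j, K ≤ j → R (j + 1) ≤ R j := fun j hj => by
    have := (hK j hj).2.2.1
    have h2 : 0 ≤ α * b j ^ 2 := by positivity
    linarith
  have hbR : ∀ j, K ≤ j → b j ≤ (R j / α) ^ (1 / 2 : ℝ) := fun j hj => by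
    rw [← Real.sqrt_eq_rpow]
    apply Real.le_sqrt_of_sq_le
    rw [le_div_iff₀ hα]
    have := (hK j hj).2.2.1
    have h2 := (hK (j + 1) (by omega)).1
    linarith
  have hbt : ∀ j, K ≤ j → b j + M * R (j + 1) ^ (1 - θ) ≤
      (R j / α) ^ (1 / 2 : ℝ) + M * R j ^ (1 - θ) := fun j hj => by
    have h1 := hbR j hj
    have h2 : R (j + 1) ^ (1 - θ) ≤ R j ^ (1 - θ) :=
      Real.rpow_le_rpow (hK _ (by omega)).1.le (hanti j hj) hθ'.le
    have := mul_le_mul_of_nonneg_left h2 hM0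
    linarith
  have hlim : Tendsto (fun j => (R j / α) ^ (1 / 2 : ℝ) + M * R j ^ (1 - θ)) atTop (𝓝 0) := by
    have h1 : Tendsto (fun j => (R j / α) ^ (1 / 2 : ℝ)) atTop (𝓝 ((0 / α) ^ (1 / 2 : ℝ))) :=
      (hR0.div_const α).rpow_const (Or.inr (by norm_num))
    have h2 : Tendsto (fun j => R j ^ (1 - θ)) atTop (𝓝 (0 ^ (1 - θ))) :=
      hR0.rpow_const (Or.inr hθ'.le)
    have h3 := h1.add (h2.const_mul M)
    rw [zero_div, Real.zero_rpow (by norm_num), Real.zero_rpow hθ'.ne'] at h3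
    simpa using h3
  have hfreq : ∀ ε > 0, ∃ᶠ j in atTop, dist (w j) x < ε := fun ε hε =>
    mapClusterPt_iff_frequently.1 hcl _ (Metric.ball_mem_nhds x hε)
  -- A late visit near the cluster point, at which the bound on all future travel is already small:
  -- together they fit in the ball of radius η, so the sequence cannot leave it afterwards.
  obtain ⟨K1, hK1⟩ : ∃ K1, K ≤ K1 ∧ dist (w (K1 + 1)) x +
      (b K1 + M * R (K1 + 1) ^ (1 - θ)) ≤ η := by
    have h1 := hlim.eventually (gt_mem_nhds (half_pos hη))
    obtain ⟨K2, hK2⟩ := eventually_atTop.1 h1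
    obtain ⟨j, hj, hjx⟩ := frequently_atTop.1 (hfreq (η / 2) (half_pos hη)) (K + K2 + 1)
    obtain ⟨i, rfl⟩ : ∃ i, j = i + 1 := ⟨j - 1, by omega⟩
    refine ⟨i, by omega, ?_⟩
    have h2 := hbt i (by omega)
    have h3 := hK2 i (by omega)
    linarith
  obtain ⟨hKK1, hK1⟩ := hK1
  have hball : ∀ n, dist (w (K1 + 1 + n)) x ≤ η := fun n => by
    have h := dist_le_of_kl (w := w) (R := R) (b := b) hα hC (by linarith) hθ K1
      (fun j hj => (hK j (by omega)).1) (fun j hj => (hK j (by omega)).2.1)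
      (fun j hj => (hK j (by omega)).2.2.1) n (fun j hj hdj => by
        refine (hK (K1 + j) (by omega)).2.2.2 ?_
        have e : K1 + j + 1 = K1 + 1 + j := by omega
        rw [e]
        have := dist_triangle (w (K1 + 1 + j)) (w (K1 + 1)) x
        rw [dist_comm (w (K1 + 1 + j)) (w (K1 + 1))] at this
        linarith)
    have := dist_triangle (w (K1 + 1 + n)) (w (K1 + 1)) x
    rw [dist_comm (w (K1 + 1 + n)) (w (K1 + 1))] at this
    linarith
  have hklall : ∀ j, K1 ≤ j → R (j + 1) ^ θ ≤ C * b j := fun j hj => by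
    refine (hK j (by omega)).2.2.2 ?_
    have := hball (j - K1)
    rwa [show K1 + 1 + (j - K1) = j + 1 by omega] at this
  have hdist : ∀ j, K1 ≤ j → dist (w (j + 1)) x ≤ (R j / α) ^ (1 / 2 : ℝ) + M * R j ^ (1 - θ) := by
    intro j hj
    refine le_trans ?_ (hbt j (by omega))
    -- The bound holds up to every later index `i`; choosing `i` with `w i` within ε of `x` replaces
    -- `w i` by the limit.
    refine le_of_forall_pos_le_add fun ε hε => ?_
    obtain ⟨i, hi, hix⟩ := frequently_atTop.1 (hfreq ε hε) (j + 1)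
    have h := dist_le_of_kl (w := w) (R := R) (b := b) hα hC (by linarith) hθ j
      (fun l hl => (hK l (by omega)).1) (fun l hl => (hK l (by omega)).2.1)
      (fun l hl => (hK l (by omega)).2.2.1) (i - (j + 1))
      (fun l hl _ => hklall (j + l) (by omega))
    rw [show j + 1 + (i - (j + 1)) = i by omega] at h
    have := dist_triangle (w (j + 1)) (w i) x
    linarith
  refine ⟨?_, ⟨(1 / α) ^ (1 / 2 : ℝ) + M, ?_⟩, ?_⟩
  · rw [← tendsto_add_atTop_iff_nat 1, tendsto_iff_dist_tendsto_zero]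
    refine squeeze_zero' (Eventually.of_forall fun _ => dist_nonneg) ?_ hlim
    filter_upwards [eventually_ge_atTop K1] with j hj using hdist j hj
  -- As `R ≤ 1` eventually and 1 - θ ≤ 1/2, the square root term is dominated by R^{1-θ}; this is
  -- where θ ≥ 1/2 enters.
  · filter_upwards [eventually_ge_atTop K1, hR0.eventually (ge_mem_nhds zero_lt_one)] with j hj hj1
    have hRj := (hK j (by omega)).1
    refine (hdist j hj).trans ?_
    rw [add_mul]
    refine add_le_add_left ?_ _
    rw [div_eq_mul_one_div, mul_comm (R j), Real.mul_rpow (by positivity) hRj.le]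
    exact mul_le_mul_of_nonneg_left
      (Real.rpow_le_rpow_of_exponent_ge hRj hj1 (by linarith)) (by positivity)
  · filter_upwards [eventually_ge_atTop K1] with j hj
    have h1 := hklall j hj
    have hRj := (hK (j + 1) (by omega)).1
    have h2 : R (j + 1) ^ (2 * θ) = (R (j + 1) ^ θ) ^ 2 := by
      rw [← Real.rpow_natCast, ← Real.rpow_mul hRj.le]; congr 1; push_cast; ring
    rw [h2]
    calc (R (j + 1) ^ θ) ^ 2 ≤ (C * b j) ^ 2 := by
          gcongr
      _ = C ^ 2 / α * (α * b j ^ 2) := by field_simp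
      _ ≤ _ := by
          have := (hK j (by omega)).2.2.1
          gcongr

/-- Geometric decay from `R (k + 1) ≤ C (R k - R (k + 1))`. -/
theorem isBigO_geometric_of_le {R : ℕ → ℝ} {C : ℝ} (hC : 0 < C) (hR : ∀ᶠ j in atTop, 0 < R j)
    (h : ∀ᶠ j in atTop, R (j + 1) ≤ C * (R j - R (j + 1))) :
    ∃ ρ ∈ Set.Ioo (0 : ℝ) 1, R =O[atTop] fun k : ℕ => ρ ^ k := by
  set ρ := C / (1 + C) with hρ
  have hρ0 : 0 < ρ := by positivity
  have hρ1 : ρ < 1 := by rw [hρ, div_lt_one (by positivity)]; linarith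
  refine ⟨ρ, ⟨hρ0, hρ1⟩, ?_⟩
  obtain ⟨K, hK⟩ := eventually_atTop.1 (hR.and h)
  have key : ∀ n, R (K + n) ≤ R K * ρ ^ n := by
    intro n
    induction n with
    | zero => simp
    | succ n ih =>
      have h1 := (hK (K + n) (by omega)).2
      have h2 : R (K + n + 1) ≤ ρ * R (K + n) := by
        rw [hρ, div_mul_eq_mul_div, le_div_iff₀ (by positivity)]; linarith
      calc R (K + (n + 1)) ≤ ρ * R (K + n) := h2
        _ ≤ ρ * (R K * ρ ^ n) := by gcongr
        _ = _ := by ring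
  refine IsBigO.of_bound (R K / ρ ^ K) ?_
  filter_upwards [eventually_ge_atTop K] with k hk
  have h1 := key (k - K)
  rw [show K + (k - K) = k by omega] at h1
  rw [Real.norm_of_nonneg (hK k hk).1.le, Real.norm_of_nonneg (by positivity)]
  refine h1.trans (le_of_eq ?_)
  rw [div_mul_eq_mul_div, eq_div_iff (by positivity), mul_assoc, ← pow_add]
  congr 2; omega

/-- Sublinear decay from `R (k + 1) ^ (1 + s) ≤ C (R k - R (k + 1))`. -/
theorem isBigO_rpow_of_le {R : ℕ → ℝ} {C s : ℝ} (hC : 0 < C) (hs0 : 0 < s) (hs1 : s ≤ 1)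
    (hR : ∀ᶠ j in atTop, 0 < R j) (hR0 : Tendsto R atTop (𝓝 0))
    (h : ∀ᶠ j in atTop, R (j + 1) ^ (1 + s) ≤ C * (R j - R (j + 1))) :
    R =O[atTop] fun k : ℕ => (k : ℝ) ^ (-(1 / s)) := by
  obtain ⟨K, hK⟩ := eventually_atTop.1
    (hR.and (h.and (hR0.eventually (ge_mem_nhds zero_lt_one))))
  have h2s : 0 < (2 : ℝ) ^ s - 1 := by
    have := Real.one_lt_rpow (by norm_num : (1 : ℝ) < 2) hs0
    linarith
  set μ := min (s / (2 * C)) ((2 : ℝ) ^ s - 1) with hμ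
  have hμ0 : 0 < μ := lt_min (by positivity) h2s
  -- R^{-s} grows by at least a fixed μ per step. If `R` at least halves, R^{-s} ≥ 1 is multiplied
  -- by 2^s or more; otherwise R_{j+1} ≥ R_j / 2 and the tangent inequality converts the recursion
  -- into a difference of s-th powers.
  have step : ∀ j, K ≤ j → (R j ^ s)⁻¹ + μ ≤ (R (j + 1) ^ s)⁻¹ := by
    intro j hj
    obtain ⟨hx, hxy, hx1⟩ := hK j hj
    have hy := (hK (j + 1) (by omega)).1
    have hxs := Real.rpow_pos_of_pos hx s
    have hys := Real.rpow_pos_of_pos hy s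
    rcases le_total (R (j + 1)) (R j / 2) with hle | hle
    · have h1 : R (j + 1) ^ s ≤ R j ^ s / 2 ^ s := by
        rw [← Real.div_rpow hx.le (by norm_num)]
        exact Real.rpow_le_rpow hy.le hle hs0.le
      have h2 : (2 : ℝ) ^ s * (R j ^ s)⁻¹ ≤ (R (j + 1) ^ s)⁻¹ := by
        rw [← inv_le_inv₀ (by positivity) hys] at h1
        simpa [div_eq_mul_inv] using h1
      have h3 : 1 ≤ (R j ^ s)⁻¹ := by
        rw [one_le_inv₀ hxs]; exact Real.rpow_le_one hx.le hx1 hs0.le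
      have h4 : μ ≤ (2 : ℝ) ^ s - 1 := min_le_right _ _
      nlinarith
    · have ht := rpow_le_tangent hy hx hs0.le hs1
      rw [Real.rpow_sub_one hx.ne'] at ht
      rw [Real.rpow_add hy, Real.rpow_one] at hxy
      have h4 : μ ≤ s / (2 * C) := min_le_left _ _
      have h5 : s / (2 * C) * (R j ^ s * R (j + 1) ^ s) ≤ R j ^ s - R (j + 1) ^ s := by
        have h6 : R (j + 1) * R (j + 1) ^ s / C ≤ R j - R (j + 1) := by
          rw [div_le_iff₀ hC]; linarith
        have h7 : s * (R j ^ s / R j) * (R (j + 1) * R (j + 1) ^ s / C) ≤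
            s * (R j ^ s / R j) * (R j - R (j + 1)) := by gcongr
        have h8 : s * (R j ^ s / R j) * (R j / 2 * R (j + 1) ^ s / C) ≤
            s * (R j ^ s / R j) * (R (j + 1) * R (j + 1) ^ s / C) := by gcongr
        have e : s * (R j ^ s / R j) * (R j / 2 * R (j + 1) ^ s / C) =
            s / (2 * C) * (R j ^ s * R (j + 1) ^ s) := by field_simp
        linarith
      have h6 : μ * (R j ^ s * R (j + 1) ^ s) ≤ R j ^ s - R (j + 1) ^ s :=
        le_trans (by gcongr) h5
      rw [← sub_nonneg]
      have e : (R (j + 1) ^ s)⁻¹ - ((R j ^ s)⁻¹ + μ) =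
          (R j ^ s - R (j + 1) ^ s - μ * (R j ^ s * R (j + 1) ^ s)) /
            (R j ^ s * R (j + 1) ^ s) := by
        field_simp
        ring
      rw [e]
      exact div_nonneg (by linarith) (by positivity)
  have key : ∀ n : ℕ, μ * n ≤ (R (K + n) ^ s)⁻¹ := by
    intro n
    induction n with
    | zero => simpa using Real.rpow_nonneg (hK K le_rfl).1.le s
    | succ n ih =>
      have := step (K + n) (by omega)
      push_cast
      rw [← add_assoc]
      linarith
  -- For k ≥ 2K + 1 one has k - K ≥ k / 2, which costs the factor 2 under μ.
  refine IsBigO.of_bound ((μ / 2) ^ (-(1 / s))) ?_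
  filter_upwards [eventually_ge_atTop (2 * K + 1)] with k hk
  have hkpos : (0 : ℝ) < k := by exact_mod_cast (by omega : 0 < k)
  have h1 := key (k - K)
  rw [show K + (k - K) = k by omega] at h1
  have hRk := (hK k (by omega)).1
  have h2 : μ / 2 * k ≤ (R k ^ s)⁻¹ := by
    refine le_trans ?_ h1
    have : (k : ℝ) / 2 ≤ ((k - K : ℕ) : ℝ) := by
      rw [Nat.cast_sub (by omega)]
      have : ((2 * K + 1 : ℕ) : ℝ) ≤ k := by exact_mod_cast hk
      push_cast at this
      linarith
    nlinarith
  rw [Real.norm_of_nonneg hRk.le, Real.norm_of_nonneg (Real.rpow_nonneg hkpos.le _),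
    ← Real.mul_rpow (by positivity) hkpos.le]
  have h3 : R k = ((R k ^ s)⁻¹) ^ (-(1 / s)) := by
    rw [← Real.rpow_neg hRk.le, ← Real.rpow_mul hRk.le]
    have : -s * -(1 / s) = 1 := by field_simp
    rw [this, Real.rpow_one]
  rw [h3]
  exact Real.rpow_le_rpow_of_nonpos (by positivity) h2 (by
    have : 0 < 1 / s := by positivity
    linarith)

end Sequences

/-! ### Quadratic models, the descent lemma and convex gradients. -/

section Hilbert

variable {E : Type*} [NormedAddCommGroup E] [InnerProductSpace ℝ E]

/-- The quadratic model is exactly quadratic around each of its points. -/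
theorem quadratic_model_sub (a c x y : E) (s : ℝ) :
    (inner ℝ a (y - c) + s / 2 * ‖y - c‖ ^ 2) - (inner ℝ a (x - c) + s / 2 * ‖x - c‖ ^ 2) =
      inner ℝ (a + s • (x - c)) (y - x) + s / 2 * ‖y - x‖ ^ 2 := by
  have e : y - c = (x - c) + (y - x) := by abel
  rw [e, @norm_add_sq_real, inner_add_right, inner_add_left, inner_smul_left]
  simp only [RCLike.conj_to_real]
  ring

/-- The variational inequality at a minimizer of the quadratic model over a convex set. -/
theorem inner_nonneg_of_isMinOn {S : Set E} (hS : Convex ℝ S) {a c x : E} {s : ℝ}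
    (hx : x ∈ S) (hmin : IsMinOn (fun y => inner ℝ a (y - c) + s / 2 * ‖y - c‖ ^ 2) S x)
    {y : E} (hy : y ∈ S) : 0 ≤ inner ℝ (a + s • (x - c)) (y - x) := by
  set A : ℝ := inner ℝ (a + s • (x - c)) (y - x) with hA
  have hlim : Tendsto (fun t : ℝ => A + s / 2 * ‖y - x‖ ^ 2 * t) (𝓝[>] 0)
      (𝓝 (A + s / 2 * ‖y - x‖ ^ 2 * 0)) :=
    ((continuous_const.add (continuous_const.mul continuous_id)).tendsto 0).mono_left
      nhdsWithin_le_nhds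
  rw [mul_zero, add_zero] at hlim
  refine ge_of_tendsto hlim ?_
  filter_upwards [Ioc_mem_nhdsGT (zero_lt_one (α := ℝ))] with t ht
  have hz : x + t • (y - x) ∈ S := hS.add_smul_sub_mem hx hy ⟨ht.1.le, ht.2⟩
  have h1 : inner ℝ a (x - c) + s / 2 * ‖x - c‖ ^ 2 ≤
    inner ℝ a (x + t • (y - x) - c) + s / 2 * ‖x + t • (y - x) - c‖ ^ 2 := hmin hz
  have h2 := quadratic_model_sub a c x (x + t • (y - x)) s
  rw [add_sub_cancel_left, inner_smul_right, ← hA, norm_smul, mul_pow, Real.norm_eq_abs,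
    sq_abs] at h2
  have h3 : 0 ≤ t * (A + s / 2 * ‖y - x‖ ^ 2 * t) := by
    have : t * (A + s / 2 * ‖y - x‖ ^ 2 * t) = t * A + s / 2 * (t ^ 2 * ‖y - x‖ ^ 2) := by ring
    rw [this]; linarith
  exact nonneg_of_mul_nonneg_right h3 ht.1

variable [CompleteSpace E]

/-- The derivative of a differentiable function along a segment. -/
theorem hasDerivAt_along_segment {f : E → ℝ} (hf : Differentiable ℝ f) (x y : E) (t : ℝ) :
    HasDerivAt (fun t : ℝ => f (x + t • (y - x)))
      (inner ℝ (gradient f (x + t • (y - x))) (y - x)) t := by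
  have h1 : HasDerivAt (fun t : ℝ => x + t • (y - x)) (y - x) t := by
    simpa using ((hasDerivAt_id t).smul_const (y - x)).const_add x
  have h2 := (hf (x + t • (y - x))).hasGradientAt.hasFDerivAt.comp_hasDerivAt t h1
  simpa [Function.comp_def] using h2

/-- The descent lemma along a segment. -/
theorem le_of_inner_gradient_le {f : E → ℝ} (hf : Differentiable ℝ f) {x y : E} {A B : ℝ}
    (h : ∀ t ∈ Set.Icc (0 : ℝ) 1, inner ℝ (gradient f (x + t • (y - x))) (y - x) ≤ A + t * B) :
    f y ≤ f x + A + B / 2 := by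
  -- Subtracting A t + (B/2) t² leaves a function with nonpositive derivative on [0, 1]; its
  -- endpoint values are then compared.
  have hd : ∀ t : ℝ, HasDerivAt (fun t : ℝ => f (x + t • (y - x)) - A * t - B / 2 * t ^ 2)
      (inner ℝ (gradient f (x + t • (y - x))) (y - x) - A - B / 2 * (2 * t)) t := fun t => by
    have h1 := hasDerivAt_along_segment hf x y t
    have h2 := (hasDerivAt_id t).const_mul A
    have h3 := (hasDerivAt_pow 2 t).const_mul (B / 2)
    exact ((h1.sub h2).sub h3).congr_deriv (by simp)
  have hanti := antitoneOn_of_deriv_nonpos (convex_Icc (0 : ℝ) 1)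
    (fun t _ => (hd t).continuousAt.continuousWithinAt)
    (fun t _ => (hd t).differentiableAt.differentiableWithinAt)
    (fun t ht => by
      rw [(hd t).deriv]
      have := h t (interior_subset ht)
      linarith)
  have := hanti (Set.left_mem_Icc.2 zero_le_one) (Set.right_mem_Icc.2 zero_le_one) zero_le_one
  simp at this
  linarith

/-- The gradient inequality for convex functions. -/
theorem inner_gradient_le_of_convexOn {h : E → ℝ} (hc : ConvexOn ℝ Set.univ h)
    (hd : Differentiable ℝ h) (x y : E) : inner ℝ (gradient h x) (y - x) ≤ h y - h x := by
  have h1 : ConvexOn ℝ Set.univ (fun t : ℝ => h (x + t • (y - x))) := by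
    have := hc.comp_affineMap (AffineMap.lineMap x y : ℝ →ᵃ[ℝ] E)
    rw [Set.preimage_univ] at this
    refine this.congr fun t _ => ?_
    simp [AffineMap.lineMap_apply, add_comm]
  have h2 := hasDerivAt_along_segment hd x y 0
  have h3 := h1.le_slope_of_hasDerivAt (Set.mem_univ 0) (Set.mem_univ 1) zero_lt_one h2
  simpa [slope] using h3

end Hilbert

/-! ### Fréchet subgradients and the Łojasiewicz inequality in real form. -/

section Subdiff

variable {E : Type*} [NormedAddCommGroup E] [InnerProductSpace ℝ E]

/-- For a differentiable function plus the indicator of a set, a vector `u` such that `u - ∇f(x)`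
is normal to the set is a Fréchet subgradient. -/
theorem mem_frechetSubdiff_of_normal [CompleteSpace E] {f : E → ℝ} {G : E → EReal} {S : Set E}
    (hS : ∀ y ∈ S, G y = f y) (hS' : ∀ y ∉ S, G y = ⊤) {x u : E} (hx : x ∈ S)
    (hf : DifferentiableAt ℝ f x)
    (hu : ∀ y ∈ S, 0 ≤ inner ℝ (gradient f x - u) (y - x)) : u ∈ frechetSubdiff G x := by
  refine ⟨by rw [hS x hx]; exact EReal.coe_lt_top _, ?_⟩
  have hε : ∀ ε : ℝ, 0 < ε → ((-ε : ℝ) : EReal) ≤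
      liminf (fun y : E => (G y - G x - ((inner ℝ u (y - x) : ℝ) : EReal)) /
        ((‖y - x‖ : ℝ) : EReal)) (𝓝[≠] x) := by
    intro ε hε
    refine le_liminf_of_le (by isBoundedDefault) ?_
    have h1 := (hasGradientAt_iff_isLittleO.1 hf.hasGradientAt).def hε
    filter_upwards [nhdsWithin_le_nhds h1, self_mem_nhdsWithin] with y hy hne
    have hpos : 0 < ‖y - x‖ := norm_pos_iff.2 (sub_ne_zero.2 hne)
    rw [EReal.le_div_iff_mul_le (by exact_mod_cast hpos) (EReal.coe_ne_top _), hS x hx]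
    by_cases hyS : y ∈ S
    · rw [hS y hyS]
      norm_cast
      have h2 := hu y hyS
      rw [inner_sub_left] at h2
      rw [Real.norm_eq_abs] at hy
      have h3 := (abs_le.1 hy).1
      linarith
    · rw [hS' y hyS, ← EReal.coe_mul, EReal.top_sub_coe, EReal.top_sub_coe]
      exact le_top
  refine le_of_forall_lt fun c hc => ?_
  obtain ⟨q, hcq, hq⟩ := EReal.lt_iff_exists_real_btwn.1 hc
  have hq0 : q < 0 := by exact_mod_cast hq
  have := hε (-q) (by linarith)
  rw [neg_neg] at this
  exact hcq.trans_le this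

/-- The Łojasiewicz inequality at a point where `G` is real valued, in real form and with an
exponent at least `1/2`. -/
theorem IsLojasiewiczExponent.rpow_le {G : E → EReal} {xbar : E} {θ gbar : ℝ}
    (h : IsLojasiewiczExponent G xbar θ) (hG : G xbar = gbar) :
    ∃ c > (0 : ℝ), ∃ η > (0 : ℝ), ∀ x u : E, ∀ g : ℝ, dist x xbar ≤ η → G x = g →
      |g - gbar| ≤ 1 → u ∈ frechetSubdiff G x → |g - gbar| ^ (max θ (1 / 2)) ≤ c * ‖u‖ := by
  obtain ⟨h0, h1, c, hc, η, hη, H⟩ := h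
  refine ⟨c, hc, η, hη, fun x u g hx hg hle hu => ?_⟩
  have h2 := H x hx
  have habs : (G x - G xbar).abs = ENNReal.ofReal |g - gbar| := by
    rw [hg, hG, ← EReal.coe_sub, EReal.abs_def]
  have hinf : Metric.infEDist (0 : E) (frechetSubdiff G x) ≤ ENNReal.ofReal ‖u‖ := by
    refine (Metric.infEDist_le_edist_of_mem hu).trans ?_
    rw [edist_dist, dist_zero_left]
  have hθ : 0 < max θ (1 / 2) := lt_max_of_lt_right (by norm_num)
  -- At zero gap the enlarged exponent is positive, so the left side vanishes; away from it `lojPow`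
  -- is an ordinary power and the convention 0^0 = 0 does not intervene.
  rcases (abs_nonneg (g - gbar)).eq_or_lt with hz | hz
  · rw [← hz, Real.zero_rpow hθ.ne']
    positivity
  · rw [habs, lojPow, if_neg (by simpa using hz), ENNReal.ofReal_rpow_of_pos hz] at h2
    have h3 := h2.trans (mul_le_mul_right hinf _)
    rw [← ENNReal.ofReal_mul hc.le, ENNReal.ofReal_le_ofReal_iff (by positivity)] at h3
    exact (Real.rpow_le_rpow_of_exponent_ge hz hle (le_max_left _ _)).trans h3

end Subdiff

/-! ### The product space and the objective `F`. -/

section Blocks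

variable {n : ℕ} {m : Fin n → ℕ}

theorem norm_le_sum_norm (x : Space m) : ‖x‖ ≤ ∑ i, ‖x i‖ := by
  refine (sq_le_sq₀ (norm_nonneg _) (Finset.sum_nonneg fun i _ => norm_nonneg _)).1 ?_
  rw [PiLp.norm_sq_eq_of_L2]
  exact Finset.sum_sq_le_sq_sum_of_nonneg fun i _ => norm_nonneg _

namespace BlockProblem

variable {p : Fin n → ℕ} (P : BlockProblem m p)

theorem F_of_mem {z : Space m} (hz : ∀ i, z i ∈ P.feas i) : P.F z = P.f z := by
  simp [F, indicatorFun, hz]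

theorem F_of_notMem {z : Space m} (hz : ¬ ∀ i, z i ∈ P.feas i) : P.F z = ⊤ := by
  push Not at hz
  obtain ⟨i, hi⟩ := hz
  have h : ∑ j, indicatorFun (P.feas j) (z j) = ⊤ := by
    have h1 : indicatorFun (P.feas i) (z i) ≤ ∑ j, indicatorFun (P.feas j) (z j) :=
      Finset.single_le_sum (f := fun j => indicatorFun (P.feas j) (z j))
        (fun j _ => by unfold indicatorFun; split_ifs <;> simp) (Finset.mem_univ i)
    rw [indicatorFun, if_neg hi] at h1
    exact top_le_iff.1 h1
  rw [F, h, EReal.coe_add_top]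

/-- The product of the feasible sets. -/
def feasProd : Set (Space m) := {z | ∀ i, z i ∈ P.feas i}

/-- Optimality in the subproblems is a variational inequality over the feasible product; this is the
passage from such inequalities to subgradients of `F`. -/
theorem mem_frechetSubdiff_F {x u : Space m} (hx : x ∈ P.feasProd)
    (hu : ∀ y ∈ P.feasProd, 0 ≤ inner ℝ (gradient P.f x - u) (y - x)) :
    u ∈ frechetSubdiff P.F x :=
  mem_frechetSubdiff_of_normal (S := P.feasProd) (fun _ hy => P.F_of_mem hy)
    (fun _ hy => P.F_of_notMem hy) hx (P.f_differentiable x) hu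

end BlockProblem

end Blocks

theorem euclidean_norm_le {d : ℕ} (x : Block d) : ‖x‖ ≤ d * ‖WithLp.ofLp x‖ := by
  have h : ‖x‖ ≤ ∑ i, ‖x i‖ := by
    refine (sq_le_sq₀ (norm_nonneg _) (Finset.sum_nonneg fun i _ => norm_nonneg _)).1 ?_
    rw [EuclideanSpace.norm_sq_eq]
    exact Finset.sum_sq_le_sq_sum_of_nonneg fun i _ => norm_nonneg _
  refine h.trans ((Finset.sum_le_card_nsmul _ _ _ fun i _ => norm_le_pi_norm x.ofLp i).trans ?_)
  simp

/-! ### Exact subproblems, the error bound and the residual. -/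

namespace BlockProblem

variable {n : ℕ} {m p : Fin n → ℕ} (P : BlockProblem m p)

/-- Compactness provides a minimizer, which makes the choice in `argminOn` meaningful. Later
arguments use minimality only, never uniqueness. -/
theorem exactIter_spec {i : Fin n} (hne : (P.feas i).Nonempty) (hc : IsCompact (P.feas i))
    (z : ℕ → Space m) (σ : ℕ → Fin n → ℝ) (k : ℕ) :
    P.exactIter z σ (k + 1) i ∈ P.feas i ∧
      IsMinOn (P.subObj z σ k i) (P.feas i) (P.exactIter z σ (k + 1) i) := by
  have hcont : Continuous (P.subObj z σ k i) := by
    unfold subObj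
    fun_prop
  obtain ⟨x, hx, hmin⟩ := hc.exists_isMinOn hne hcont.continuousOn
  exact Classical.epsilon_spec (p := fun x => x ∈ P.feas i ∧ IsMinOn (P.subObj z σ k i) (P.feas i) x)
    ⟨x, hx, hmin⟩

/-- The optimality condition of the exact subproblem. -/
theorem exactIter_inner_nonneg {i : Fin n} (hne : (P.feas i).Nonempty) (hconv : Convex ℝ (P.feas i))
    (hc : IsCompact (P.feas i)) (z : ℕ → Space m) (σ : ℕ → Fin n → ℝ) (k : ℕ)
    {y : Block (m i)} (hy : y ∈ P.feas i) :
    0 ≤ inner ℝ (P.partialGrad i (mixed z k i) + σ k i • (P.exactIter z σ (k + 1) i - z k i))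
      (y - P.exactIter z σ (k + 1) i) := by
  obtain ⟨h1, h2⟩ := P.exactIter_spec hne hc z σ k
  exact inner_nonneg_of_isMinOn hconv h1 h2 hy

theorem feas_subset_enlarged {εbar : ℝ} (hε : 0 ≤ εbar) (i : Fin n) :
    P.feas i ⊆ P.enlarged εbar i := fun x hx => by
  rw [enlarged, Set.mem_ofPred_eq, Metric.infDist_zero_of_mem hx]
  exact hε

theorem feasProd_subset_enlargedProd {εbar : ℝ} (hε : 0 ≤ εbar) :
    P.feasProd ⊆ P.enlargedProd εbar := fun _ hx i => P.feas_subset_enlarged hε i (hx i)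

theorem convex_feasProd (h : ∀ i, Convex ℝ (P.feas i)) : Convex ℝ P.feasProd := by
  intro x hx y hy a b ha hb hab i
  exact h i (hx i) (hy i) ha hb hab

theorem isCompact_feasProd (h : ∀ i, IsCompact (P.feas i)) : IsCompact P.feasProd := by
  have h1 : IsCompact (Set.univ.pi P.feas) := isCompact_univ_pi h
  have h2 := h1.image (PiLp.continuous_toLp 2 (fun i : Fin n => Block (m i)))
  convert h2 using 1
  ext x
  constructor
  · intro hx
    exact ⟨WithLp.ofLp x, fun i _ => hx i, rfl⟩
  · rintro ⟨y, hy, rfl⟩ i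
    exact hy i trivial

theorem exists_norm_le_of_enlarged {εbar : ℝ} {i : Fin n} (hne : (P.feas i).Nonempty)
    (hc : IsCompact (P.feas i)) : ∃ B, ∀ x ∈ P.enlarged εbar i, ‖x‖ ≤ B := by
  obtain ⟨B, hB⟩ := hc.isBounded.exists_norm_le
  refine ⟨B + εbar, fun x hx => ?_⟩
  obtain ⟨s, hs, hd⟩ := hc.exists_infDist_eq_dist hne x
  rw [enlarged, Set.mem_ofPred_eq, hd, dist_eq_norm] at hx
  have h1 := norm_add_le (x - s) s
  rw [sub_add_cancel] at h1
  linarith [hB s hs]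

theorem exists_partialGrad_le {εbar : ℝ} {Lip : Fin n → ℝ} (hε : 0 ≤ εbar)
    (hLip : P.LipschitzBlocks εbar Lip) (hne : ∀ i, (P.feas i).Nonempty)
    (hc : ∀ i, IsCompact (P.feas i)) (i : Fin n) :
    ∃ B, ∀ x ∈ P.enlargedProd εbar, ‖P.partialGrad i x‖ ≤ B := by
  choose B hB using fun i => P.exists_norm_le_of_enlarged (εbar := εbar) (hne i) (hc i)
  choose s hs using hne
  have hs' : WithLp.toLp 2 s ∈ P.enlargedProd εbar := fun i => P.feas_subset_enlarged hε i (hs i)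
  have hb : ∀ x ∈ P.enlargedProd εbar, ‖x‖ ≤ ∑ i, B i := fun x hx =>
    (norm_le_sum_norm x).trans (Finset.sum_le_sum fun i _ => hB i _ (hx i))
  refine ⟨‖P.partialGrad i (WithLp.toLp 2 s)‖ + Lip i * (∑ i, B i + ∑ i, B i), fun x hx => ?_⟩
  have h1 := (hLip i).2 x hx _ hs'
  have h2 := norm_sub_le x (WithLp.toLp 2 s)
  have h3 := hb x hx
  have h4 := hb _ hs'
  have h5 : ‖x - WithLp.toLp 2 s‖ ≤ ∑ i, B i + ∑ i, B i := by linarith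
  have h6 := mul_le_mul_of_nonneg_left h5 (hLip i).1.le
  have h7 := norm_add_le (P.partialGrad i x - P.partialGrad i (WithLp.toLp 2 s))
    (P.partialGrad i (WithLp.toLp 2 s))
  rw [sub_add_cancel] at h7
  linarith

/-- The Hoffman-like bound in the sup norm extends from the enlarged set to all points at which the
constraint violation is small. -/
theorem exists_infDist_le_of_hoffman {εbar Ml : ℝ} {i : Fin n} (hε : 0 < εbar) (hMl : 0 ≤ Ml)
    (hne : (P.feas i).Nonempty) (hH : P.HoffmanBound εbar Ml i) :
    ∃ c, 0 ≤ c ∧ ∀ x t, 0 ≤ t → c * t < εbar → (∀ j, P.h i j x ≤ t) →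
      Metric.infDist x (P.feas i) ≤ c * t := by
  obtain ⟨c, hc, hb⟩ := hH
  have hgb : 0 ≤ P.gradBound εbar i :=
    Real.sSup_nonneg (by rintro _ ⟨z, -, rfl⟩; exact norm_nonneg _)
  have hin : ∀ x ∈ P.enlarged εbar i, ∀ t, 0 ≤ t → (∀ j, P.h i j x ≤ t) →
      Metric.infDist x (P.feas i) ≤ c * p i * t := by
    intro x hx t ht hj
    -- A point of the enlarged set is at distance 0 from it, so the Hoffman premise holds whatever
    -- its radius.
    refine (hb x (by rw [Metric.infDist_zero_of_mem hx]; positivity)).trans ?_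
    rw [mul_assoc]
    refine mul_le_mul_of_nonneg_left ((euclidean_norm_le _).trans ?_) hc
    refine mul_le_mul_of_nonneg_left ?_ (Nat.cast_nonneg _)
    refine (pi_norm_le_iff_of_nonneg ht).2 fun j => ?_
    rw [Real.norm_of_nonneg (le_max_right _ _)]
    exact max_le (hj j) ht
  refine ⟨c * p i, by positivity, fun x t ht hct hj => ?_⟩
  by_cases hx : Metric.infDist x (P.feas i) ≤ εbar
  · exact hin x hx t ht hj
  -- Otherwise the segment from a feasible point to `x` meets the level `infDist = εbar`. By
  -- convexity the violation there is still at most `t`, so the bound gives εbar ≤ c t, against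
  -- `hct`.
  exfalso
  push Not at hx
  obtain ⟨s, hs⟩ := hne
  have hcont : Continuous fun τ : ℝ => Metric.infDist (s + τ • (x - s)) (P.feas i) :=
    (Metric.continuous_infDist_pt _).comp (by fun_prop)
  have hivt := intermediate_value_Icc (zero_le_one (α := ℝ)) hcont.continuousOn
  obtain ⟨τ, hτ, hτe⟩ := hivt (show εbar ∈ Set.Icc _ _ by
    simp only [zero_smul, add_zero, one_smul, add_sub_cancel, Metric.infDist_zero_of_mem hs]
    exact ⟨hε.le, hx.le⟩)
  have h1 := hin (s + τ • (x - s)) hτe.le t ht fun j => by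
    have h2 := (P.h_convex i j).2 (Set.mem_univ s) (Set.mem_univ x) (sub_nonneg.2 hτ.2) hτ.1
      (by ring)
    have e : (1 - τ) • s + τ • x = s + τ • (x - s) := by module
    rw [e, smul_eq_mul, smul_eq_mul] at h2
    have h3 := mul_le_mul_of_nonneg_left (hs j) (sub_nonneg.2 hτ.2)
    have h4 := mul_le_mul_of_nonneg_left (hj j) hτ.1
    have h5 := mul_le_mul_of_nonneg_right hτ.2 ht
    linarith
  dsimp only at hτe
  linarith

section Residual

variable {P} {i : Fin n} {x xt : Block (m i)} {lam : Fin (p i) → ℝ}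

theorem inner_le_residual :
    inner ℝ x (x - xt + P.jacMul i x lam) + max (-(∑ j, lam j * P.h i j x)) 0 ≤
      P.residual i x lam xt := by
  have h1 := le_max_left (inner ℝ x (x - xt + P.jacMul i x lam)) 0
  have h2 := norm_nonneg (WithLp.ofLp (x - xt + P.jacMul i x lam))
  have h3 := norm_nonneg (fun j => max (P.h i j x) 0)
  unfold residual
  linarith

theorem norm_le_residual : ‖WithLp.ofLp (x - xt + P.jacMul i x lam)‖ ≤ P.residual i x lam xt := by
  have h1 := le_max_right (inner ℝ x (x - xt + P.jacMul i x lam)) 0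
  have h3 := norm_nonneg (fun j => max (P.h i j x) 0)
  have h4 := le_max_right (-(∑ j, lam j * P.h i j x)) 0
  unfold residual
  linarith

theorem constraint_le_residual (j : Fin (p i)) : P.h i j x ≤ P.residual i x lam xt := by
  have h1 := le_max_right (inner ℝ x (x - xt + P.jacMul i x lam)) 0
  have h2 := norm_nonneg (WithLp.ofLp (x - xt + P.jacMul i x lam))
  have h3 := norm_le_pi_norm (fun j => max (P.h i j x) 0) j
  have h4 := le_max_right (-(∑ j, lam j * P.h i j x)) 0
  have h5 := le_max_left (P.h i j x) 0
  rw [Real.norm_of_nonneg (le_max_right _ _)] at h3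
  unfold residual
  linarith

/-- The residual and the infeasibility control the squared distance to the projection of `x̃`
onto the feasible set. -/
theorem norm_sub_sq_le_residual (hc : IsCompact (P.feas i)) {xb : Block (m i)}
    (hxb : xb ∈ P.feas i) (hvi : ∀ y ∈ P.feas i, 0 ≤ inner ℝ (xb - xt) (y - xb))
    (hlam : ∀ j, 0 ≤ lam j) :
    ‖x - xb‖ ^ 2 ≤ P.residual i x lam xt * (1 + m i * ‖xb‖) +
      ‖xb - xt‖ * Metric.infDist x (P.feas i) := by
  set g := x - xt + P.jacMul i x lam with hg
  -- The gradient inequality gives ⟨∇h(x)λ, xb - x⟩ ≤ ⟨λ, h(xb)⟩ - ⟨λ, h(x)⟩, and ⟨λ, h(xb)⟩ ≤ 0;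
  -- what remains is the complementarity term of the residual.
  have h1 : inner ℝ (P.jacMul i x lam) (xb - x) ≤ max (-(∑ j, lam j * P.h i j x)) 0 := by
    refine le_trans ?_ (le_max_left _ _)
    rw [jacMul, sum_inner, ← Finset.sum_neg_distrib]
    refine Finset.sum_le_sum fun j _ => ?_
    rw [inner_smul_left, RCLike.conj_to_real]
    have h := mul_le_mul_of_nonneg_left
      (inner_gradient_le_of_convexOn (P.h_convex i j) (P.h_differentiable i j) x xb) (hlam j)
    have h' := mul_le_mul_of_nonneg_left (hxb j) (hlam j)
    linarith
  obtain ⟨s, hs, hds⟩ := hc.exists_infDist_eq_dist ⟨xb, hxb⟩ x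
  -- `x` need not be feasible, so the variational inequality is applied to its nearest feasible
  -- point `s`; the distance to `s` is the extra cost.
  have h2 : -(‖xb - xt‖ * Metric.infDist x (P.feas i)) ≤ inner ℝ (xb - xt) (x - xb) := by
    have e : x - xb = (x - s) + (s - xb) := by abel
    rw [e, inner_add_right, hds, dist_eq_norm]
    have := (abs_le.1 (abs_real_inner_le_norm (xb - xt) (x - s))).1
    linarith [hvi s hs]
  have h3 : inner ℝ g (xb - x) = inner ℝ g xb - inner ℝ x g := by
    rw [inner_sub_right, real_inner_comm x g]
  have h4 : -(‖g‖ * ‖xb‖) ≤ inner ℝ g xb := (abs_le.1 (abs_real_inner_le_norm g xb)).1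
  have h5 : ‖g‖ ≤ m i * P.residual i x lam xt :=
    (euclidean_norm_le g).trans (mul_le_mul_of_nonneg_left norm_le_residual (Nat.cast_nonneg _))
  have h6 := mul_le_mul_of_nonneg_right h5 (norm_nonneg xb)
  have h7 := inner_le_residual (P := P) (x := x) (xt := xt) (lam := lam)
  have h8 : ‖x - xb‖ ^ 2 = inner ℝ (P.jacMul i x lam) (xb - x) - inner ℝ g (xb - x) -
      inner ℝ (xb - xt) (x - xb) := by
    have e : x - xb = g - P.jacMul i x lam - (xb - xt) := by rw [hg]; abel
    rw [← real_inner_self_eq_norm_sq, ← neg_sub x xb, inner_neg_right, inner_neg_right]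
    nth_rewrite 1 [e]
    rw [inner_sub_left, inner_sub_left]
    ring
  rw [← hg] at h7
  linarith

end Residual

theorem IsRun.residual_le {P : BlockProblem m p} {ε : ℕ → ℝ} {Ml Mu : ℝ} {z : ℕ → Space m}
    {σ : ℕ → Fin n → ℝ} (h : P.IsRun ε Ml Mu z σ) (k : ℕ) (i : Fin n) :
    ∃ lam : Fin (p i) → ℝ, (∀ j, 0 ≤ lam j) ∧
      P.residual i (z (k + 1) i) lam (P.gradStep z σ k i) ≤ ε k ^ 2 := by
  obtain ⟨lam, h1, h2⟩ := h.inexact k i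
  exact ⟨lam, h1, (Real.sqrt_le_iff.1 h2).2⟩

end BlockProblem

/-! ### Inexactness, descent and subgradient estimates along the exact iterates. -/

namespace BlockProblem

variable {n : ℕ} {m p : Fin n → ℕ} (P : BlockProblem m p)

/-- The standing assumptions, with a common block Lipschitz modulus `ℓ > 0`. -/
structure Setting (εbar ρ γ ℓ Mu : ℝ) (z : ℕ → Space m) (σ : ℕ → Fin n → ℝ) : Prop where
  εbar_pos : 0 < εbar
  ρ_pos : 0 < ρ
  ρ_lt : ρ < 1
  γ_gt : 1 < γ
  ℓ_pos : 0 < ℓ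
  lipschitz : ∀ i, ∀ z₁ ∈ P.enlargedProd εbar, ∀ z₂ ∈ P.enlargedProd εbar,
    ‖P.partialGrad i z₁ - P.partialGrad i z₂‖ ≤ ℓ * ‖z₁ - z₂‖
  nonempty : ∀ i, (P.feas i).Nonempty
  convex : ∀ i, Convex ℝ (P.feas i)
  compact : ∀ i, IsCompact (P.feas i)
  hoffman : ∀ i, P.HoffmanBound εbar (γ * ℓ) i
  run : P.IsRun (fun k => εbar * ρ ^ k) (γ * ℓ) Mu z σ

/-- The block descent inequality on the feasible product. -/
theorem f_le_of_block {ℓ : ℝ} {i : Fin n} {x y : Space m} (hconv : ∀ i, Convex ℝ (P.feas i))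
    (hLip : ∀ z₁ ∈ P.feasProd, ∀ z₂ ∈ P.feasProd,
      ‖P.partialGrad i z₁ - P.partialGrad i z₂‖ ≤ ℓ * ‖z₁ - z₂‖)
    (hx : x ∈ P.feasProd) (hy : y ∈ P.feasProd) (hxy : ∀ j, j ≠ i → y j = x j) :
    P.f y ≤ P.f x + inner ℝ (P.partialGrad i x) (y i - x i) + ℓ / 2 * ‖y i - x i‖ ^ 2 := by
  have hz : ∀ j, j ≠ i → (y - x) j = 0 := fun j hj => by
    rw [PiLp.sub_apply, hxy j hj, sub_self]
  have hnorm : ‖y - x‖ = ‖y i - x i‖ := by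
    have h : ‖y - x‖ ^ 2 = ‖y i - x i‖ ^ 2 := by
      rw [PiLp.norm_sq_eq_of_L2, Finset.sum_eq_single i (fun j _ hj => by rw [hz j hj]; simp)
        (fun h => absurd (Finset.mem_univ i) h), PiLp.sub_apply]
    exact (sq_eq_sq₀ (norm_nonneg _) (norm_nonneg _)).1 h
  have hinner : ∀ v : Space m, inner ℝ v (y - x) = inner ℝ (v i) (y i - x i) := fun v => by
    rw [PiLp.inner_apply, Finset.sum_eq_single i (fun j _ hj => by rw [hz j hj, inner_zero_right])
      (fun h => absurd (Finset.mem_univ i) h), PiLp.sub_apply]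
  have h := le_of_inner_gradient_le P.f_differentiable (x := x) (y := y)
    (A := inner ℝ (P.partialGrad i x) (y i - x i)) (B := ℓ * ‖y i - x i‖ ^ 2) fun t ht => by
      rw [hinner]
      have hmem : x + t • (y - x) ∈ P.feasProd :=
        (P.convex_feasProd hconv).add_smul_sub_mem hx hy ht
      have h1 := hLip _ hmem _ hx
      rw [add_sub_cancel_left, norm_smul, hnorm, Real.norm_of_nonneg ht.1] at h1
      have h2 := real_inner_le_norm (P.partialGrad i (x + t • (y - x)) - P.partialGrad i x)
        (y i - x i)
      rw [inner_sub_left] at h2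
      have h3 := mul_le_mul_of_nonneg_right h1 (norm_nonneg (y i - x i))
      change inner ℝ (P.partialGrad i (x + t • (y - x))) (y i - x i) ≤ _
      linarith
  linarith

/-- The sufficient decrease along an exact block update at an inexact linearization point. -/
theorem inner_partialGrad_le {i : Fin n} (hne : (P.feas i).Nonempty) (hconv : Convex ℝ (P.feas i))
    (hc : IsCompact (P.feas i)) (z : ℕ → Space m) (σ : ℕ → Fin n → ℝ) (k : ℕ)
    (hσ : 0 ≤ σ k i) {y : Block (m i)} (hy : y ∈ P.feas i) :
    inner ℝ (P.partialGrad i (mixed z k i)) (P.exactIter z σ (k + 1) i - y) ≤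
      σ k i / 2 * ‖y - z k i‖ ^ 2 - σ k i / 2 * ‖P.exactIter z σ (k + 1) i - y‖ ^ 2 := by
  have h1 := P.exactIter_inner_nonneg hne hconv hc z σ k hy
  have h2 := quadratic_model_sub (P.partialGrad i (mixed z k i)) (z k i)
    (P.exactIter z σ (k + 1) i) y (σ k i)
  have h3 : 0 ≤ σ k i / 2 * ‖P.exactIter z σ (k + 1) i - z k i‖ ^ 2 := by positivity
  have e : P.exactIter z σ (k + 1) i - y = (P.exactIter z σ (k + 1) i - z k i) - (y - z k i) := by
    abel
  rw [norm_sub_rev (P.exactIter z σ (k + 1) i) y, e, inner_sub_right]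
  linarith

variable {P} {εbar ρ γ ℓ Mu : ℝ} {z : ℕ → Space m} {σ : ℕ → Fin n → ℝ}

namespace Setting

theorem σ_pos (h : P.Setting εbar ρ γ ℓ Mu z σ) (k : ℕ) (i : Fin n) : 0 < σ k i :=
  (mul_pos (by linarith [h.γ_gt]) h.ℓ_pos).trans_le (h.run.prox_mem k i).1

theorem exactIter_mem (h : P.Setting εbar ρ γ ℓ Mu z σ) (k : ℕ) :
    P.exactIter z σ (k + 1) ∈ P.feasProd :=
  fun i => (P.exactIter_spec (h.nonempty i) (h.compact i) z σ k).1

theorem lipschitz_feasProd (h : P.Setting εbar ρ γ ℓ Mu z σ) (i : Fin n) :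
    ∀ z₁ ∈ P.feasProd, ∀ z₂ ∈ P.feasProd,
      ‖P.partialGrad i z₁ - P.partialGrad i z₂‖ ≤ ℓ * ‖z₁ - z₂‖ := fun _ h1 _ h2 =>
  h.lipschitz i _ (P.feasProd_subset_enlargedProd h.εbar_pos.le h1) _
    (P.feasProd_subset_enlargedProd h.εbar_pos.le h2)

theorem tendsto_sq_pow (h : P.Setting εbar ρ γ ℓ Mu z σ) (c : ℝ) :
    Tendsto (fun k : ℕ => c * (εbar * ρ ^ k) ^ 2) atTop (𝓝 0) := by
  have h1 := tendsto_pow_atTop_nhds_zero_of_lt_one h.ρ_pos.le h.ρ_lt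
  simpa using ((h1.const_mul εbar).pow 2).const_mul c

/-- The bound is quadratic in the tolerance because the test controls the square root of the
residual. It holds eventually, once c ε_k² < εbar. -/
theorem exists_infDist_le (h : P.Setting εbar ρ γ ℓ Mu z σ) (i : Fin n) :
    ∃ c, 0 ≤ c ∧ ∀ᶠ k in atTop,
      Metric.infDist (z (k + 1) i) (P.feas i) ≤ c * (εbar * ρ ^ k) ^ 2 := by
  obtain ⟨c, hc, H⟩ := P.exists_infDist_le_of_hoffman h.εbar_pos
    (mul_pos (by linarith [h.γ_gt]) h.ℓ_pos).le (h.nonempty i) (h.hoffman i)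
  refine ⟨c, hc, ?_⟩
  filter_upwards [(h.tendsto_sq_pow c).eventually (gt_mem_nhds h.εbar_pos)] with k hk
  obtain ⟨lam, -, hr⟩ := h.run.residual_le k i
  exact H _ _ (sq_nonneg _) hk fun j => (constraint_le_residual j).trans hr

/-- The gradient is Lipschitz only on the enlarged product, so the infeasible iterates must be
located there before gradients at them can be compared. -/
theorem eventually_mem_enlargedProd (h : P.Setting εbar ρ γ ℓ Mu z σ) :
    ∀ᶠ k in atTop, z k ∈ P.enlargedProd εbar := by
  refine eventually_all.2 fun i => ?_
  obtain ⟨c, -, H⟩ := h.exists_infDist_le i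
  have h1 : ∀ᶠ k in atTop, z (k + 1) i ∈ P.enlarged εbar i := by
    filter_upwards [H, (h.tendsto_sq_pow c).eventually (gt_mem_nhds h.εbar_pos)] with k h1 h2
      using h1.trans h2.le
  exact tendsto_principal.1 ((tendsto_add_atTop_iff_nat (f := fun k => z k i) 1).1
    (tendsto_principal.2 h1))

theorem eventually_mixed_mem (h : P.Setting εbar ρ γ ℓ Mu z σ) :
    ∀ᶠ k in atTop, ∀ i, mixed z k i ∈ P.enlargedProd εbar := by
  filter_upwards [h.eventually_mem_enlargedProd,
    (tendsto_add_atTop_nat 1).eventually h.eventually_mem_enlargedProd] with k h1 h2 i j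
  change (if j < i then z (k + 1) j else z k j) ∈ _
  split_ifs
  exacts [h2 j, h1 j]

/-- Blockwise error between the inexact and the exact iterates. -/
theorem exists_block_error (h : P.Setting εbar ρ γ ℓ Mu z σ) (i : Fin n) :
    ∃ C, 0 ≤ C ∧ ∀ᶠ k in atTop,
      ‖z (k + 1) i - P.exactIter z σ (k + 1) i‖ ≤ C * ρ ^ k := by
  obtain ⟨c, hc, H⟩ := h.exists_infDist_le i
  obtain ⟨B, hB⟩ := P.exists_norm_le_of_enlarged (εbar := εbar) (h.nonempty i) (h.compact i)
  obtain ⟨G, hG⟩ := P.exists_partialGrad_le h.εbar_pos.le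
    (Lip := fun _ => ℓ) (fun i => ⟨h.ℓ_pos, h.lipschitz i⟩) h.nonempty h.compact i
  have hMl : 0 < γ * ℓ := mul_pos (by linarith [h.γ_gt]) h.ℓ_pos
  set T := B + B + 1 / (γ * ℓ) * G with hT
  set A := 1 + m i * B + T * c with hA
  have hB0 : 0 ≤ B := (norm_nonneg _).trans
    (hB _ (P.feas_subset_enlarged h.εbar_pos.le i (h.exactIter_mem 0 i)))
  refine ⟨√A * εbar, mul_nonneg (Real.sqrt_nonneg _) h.εbar_pos.le, ?_⟩
  filter_upwards [H, h.eventually_mem_enlargedProd, h.eventually_mixed_mem] with k hk1 hk2 hk3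
  obtain ⟨lam, hlam, hr⟩ := h.run.residual_le k i
  set xb := P.exactIter z σ (k + 1) i with hxb
  have hxbm : xb ∈ P.feas i := h.exactIter_mem k i
  have hσ := h.σ_pos k i
  -- Up to the positive factor 1/σ this is the gradient of the subproblem at its solution; hence
  -- `xb` satisfies the variational inequality of the projection of x̃ onto the feasible set.
  have hxt : xb - P.gradStep z σ k i =
      (1 / σ k i) • (P.partialGrad i (mixed z k i) + σ k i • (xb - z k i)) := by
    rw [gradStep, smul_add, smul_smul, one_div_mul_cancel hσ.ne', one_smul]
    abel
  have h1 := norm_sub_sq_le_residual (x := z (k + 1) i) (xt := P.gradStep z σ k i) (h.compact i)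
    hxbm (fun y hy => by
      rw [hxt, inner_smul_left, RCLike.conj_to_real]
      exact mul_nonneg (by positivity)
        (P.exactIter_inner_nonneg (h.nonempty i) (h.convex i) (h.compact i) z σ k hy)) hlam
  have hxbB : ‖xb‖ ≤ B := hB _ (P.feas_subset_enlarged h.εbar_pos.le i hxbm)
  have hzB : ‖z k i‖ ≤ B := hB _ (hk2 i)
  have h2 : ‖xb - P.gradStep z σ k i‖ ≤ T := by
    have e : xb - P.gradStep z σ k i =
        (xb - z k i) + (1 / σ k i) • P.partialGrad i (mixed z k i) := by
      rw [gradStep]; abel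
    rw [e, hT]
    have h3 : ‖(1 / σ k i) • P.partialGrad i (mixed z k i)‖ ≤ 1 / (γ * ℓ) * G := by
      rw [norm_smul, Real.norm_of_nonneg (by positivity)]
      exact mul_le_mul (one_div_le_one_div_of_le hMl (h.run.prox_mem k i).1) (hG _ (hk3 i))
        (norm_nonneg _) (by positivity)
    have h4 := norm_add_le (xb - z k i) ((1 / σ k i) • P.partialGrad i (mixed z k i))
    have h5 := norm_sub_le xb (z k i)
    linarith
  have h3 : ‖z (k + 1) i - xb‖ ^ 2 ≤ A * (εbar * ρ ^ k) ^ 2 := by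
    have h4 : P.residual i (z (k + 1) i) lam (P.gradStep z σ k i) * (1 + m i * ‖xb‖) ≤
        (εbar * ρ ^ k) ^ 2 * (1 + m i * B) := by gcongr
    have h5 : ‖xb - P.gradStep z σ k i‖ * Metric.infDist (z (k + 1) i) (P.feas i) ≤
        T * (c * (εbar * ρ ^ k) ^ 2) :=
      mul_le_mul h2 hk1 Metric.infDist_nonneg ((norm_nonneg _).trans h2)
    rw [hA]
    linarith
  have h4 := Real.le_sqrt_of_sq_le h3
  have hp : 0 ≤ εbar * ρ ^ k := mul_nonneg h.εbar_pos.le (pow_nonneg h.ρ_pos.le k)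
  rwa [Real.sqrt_mul' _ (sq_nonneg _), Real.sqrt_sq hp, ← mul_assoc] at h4

/-- The error between the inexact and the exact iterates decays geometrically. -/
theorem exists_error_le (h : P.Setting εbar ρ γ ℓ Mu z σ) :
    ∃ C, 0 ≤ C ∧ ∀ᶠ k in atTop, ‖z k - P.exactIter z σ k‖ ≤ C * ρ ^ k := by
  choose C hC H using h.exists_block_error
  have hs : 0 ≤ ∑ i, C i := Finset.sum_nonneg fun i _ => hC i
  -- Dividing by ρ compensates the shift: the error at index k + 1 is measured by ρ^k.
  refine ⟨(∑ i, C i) / ρ, div_nonneg hs h.ρ_pos.le, ?_⟩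
  have h1 := eventually_all.2 H
  obtain ⟨K, hK⟩ := eventually_atTop.1 h1
  filter_upwards [eventually_ge_atTop (K + 1)] with k hk
  obtain ⟨k, rfl⟩ : ∃ j, k = j + 1 := ⟨k - 1, by omega⟩
  refine (norm_le_sum_norm _).trans ?_
  have e : (∑ i, C i) / ρ * ρ ^ (k + 1) = ∑ i, C i * ρ ^ k := by
    rw [← Finset.sum_mul, pow_succ]
    have := h.ρ_pos.ne'
    field_simp
  rw [e]
  exact Finset.sum_le_sum fun i _ => hK k (by omega) i

theorem exists_error_le_succ (h : P.Setting εbar ρ γ ℓ Mu z σ) :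
    ∃ C, 0 ≤ C ∧ ∀ᶠ k in atTop, ‖z k - P.exactIter z σ k‖ ≤ C * ρ ^ k ∧
      ‖z (k + 1) - P.exactIter z σ (k + 1)‖ ≤ C * ρ ^ k := by
  obtain ⟨C, hC, H⟩ := h.exists_error_le
  refine ⟨C, hC, ?_⟩
  filter_upwards [H, (tendsto_add_atTop_nat 1).eventually H] with k h1 h2
  exact ⟨h1, h2.trans (mul_le_mul_of_nonneg_left
    (pow_le_pow_of_le_one h.ρ_pos.le h.ρ_lt.le (Nat.le_succ k)) hC)⟩

/-- Sufficient decrease of `f` along the exact iterates, up to a geometric error. -/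
theorem exists_descent (h : P.Setting εbar ρ γ ℓ Mu z σ) :
    ∃ B, 0 ≤ B ∧ ∀ᶠ k in atTop,
      P.f (P.exactIter z σ (k + 1)) +
        (γ - 1) * ℓ / 4 * ‖P.exactIter z σ (k + 1) - P.exactIter z σ k‖ ^ 2 ≤
      P.f (P.exactIter z σ k) + B * (ρ ^ 2) ^ k := by
  obtain ⟨C, hC, H⟩ := h.exists_error_le_succ
  have hγ : 0 < γ - 1 := by linarith [h.γ_gt]
  have hℓ := h.ℓ_pos
  set D := ℓ * n ^ 2 / (γ - 1) + |Mu| / 2 with hD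
  refine ⟨n * (D * C ^ 2), by positivity, ?_⟩
  filter_upwards [H, h.eventually_mixed_mem, eventually_ge_atTop 1] with k ⟨he, he'⟩ hmix hk1
  obtain ⟨k', rfl⟩ : ∃ j, k = j + 1 := ⟨k - 1, by omega⟩
  set k := k' + 1 with hk
  set w := P.exactIter z σ with hw
  set e := C * ρ ^ k with hedef
  have hwk : w k ∈ P.feasProd := h.exactIter_mem k'
  have hwk' : w (k + 1) ∈ P.feasProd := h.exactIter_mem k
  -- Feasible interpolation from `w k` to `w (k + 1)`, one block at a time. `W i` is the exact
  -- counterpart of `mixed z k i` and differs from it only by the inexactness.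
  let W : ℕ → Space m := fun j => WithLp.toLp 2 fun l => if l.val < j then w (k + 1) l else w k l
  have hWm : ∀ j, W j ∈ P.feasProd := fun j l => by
    change (if l.val < j then w (k + 1) l else w k l) ∈ _
    split_ifs
    exacts [hwk' l, hwk l]
  have hW0 : W 0 = w k := by
    ext l : 1
    simp [W]
  have hWn : W n = w (k + 1) := by
    ext l : 1
    simp [W]
  have hstep : ∀ i : Fin n, P.f (W (i + 1)) + (γ - 1) * ℓ / 4 * ‖w (k + 1) i - w k i‖ ^ 2 ≤
      P.f (W i) + D * e ^ 2 := by
    intro i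
    have hWi : W i i = w k i := by simp [W]
    have hWi' : W (i + 1) i = w (k + 1) i := by simp [W]
    have h1 := P.f_le_of_block h.convex (h.lipschitz_feasProd i) (hWm i) (hWm (i + 1))
      (fun j hj => by
        have : j.val ≠ i.val := fun hh => hj (Fin.ext hh)
        simp only [W]
        congr 1
        exact propext (by omega))
    rw [hWi, hWi'] at h1
    set Δ := w (k + 1) i - w k i with hΔ
    have hσ := h.σ_pos k i
    obtain ⟨hσ1, hσ2⟩ := h.run.prox_mem k i
    have h2 := P.inner_partialGrad_le (h.nonempty i) (h.convex i) (h.compact i) z σ k hσ.le (hwk i)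
    rw [← hw, ← hΔ] at h2
    have h3 : ‖W i - mixed z k i‖ ≤ n * e := by
      refine (norm_le_sum_norm _).trans ((Finset.sum_le_card_nsmul _ _ e fun l _ => ?_).trans ?_)
      · rw [PiLp.sub_apply]
        change ‖(if l.val < i.val then w (k + 1) l else w k l) -
          (if l < i then z (k + 1) l else z k l)‖ ≤ e
        by_cases hl : l < i
        · rw [if_pos hl, if_pos (by exact hl), norm_sub_rev]
          exact (PiLp.norm_apply_le (z (k + 1) - w (k + 1)) l).trans he'
        · rw [if_neg hl, if_neg (by exact hl), norm_sub_rev]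
          exact (PiLp.norm_apply_le (z k - w k) l).trans he
      · simp
    have h4 := h.lipschitz i _ (P.feasProd_subset_enlargedProd h.εbar_pos.le (hWm i)) _ (hmix i)
    have h5 := real_inner_le_norm (P.partialGrad i (W i) - P.partialGrad i (mixed z k i)) Δ
    rw [inner_sub_left] at h5
    have h6 : ‖P.partialGrad i (W i) - P.partialGrad i (mixed z k i)‖ * ‖Δ‖ ≤
        ℓ * (n * e) * ‖Δ‖ :=
      mul_le_mul_of_nonneg_right (h4.trans (mul_le_mul_of_nonneg_left h3 hℓ.le)) (norm_nonneg _)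
    -- Young's inequality, weighted to spend half of the available (γ - 1)ℓ/2 on the gradient error;
    -- the other half is the decrease retained.
    have h7 : ℓ * (n * e) * ‖Δ‖ ≤ (γ - 1) * ℓ / 4 * ‖Δ‖ ^ 2 + ℓ * n ^ 2 / (γ - 1) * e ^ 2 := by
      have h8 : 0 ≤ ℓ / (γ - 1) * ((γ - 1) / 2 * ‖Δ‖ - n * e) ^ 2 := by positivity
      have e8 : ℓ / (γ - 1) * ((γ - 1) / 2 * ‖Δ‖ - n * e) ^ 2 =
          (γ - 1) * ℓ / 4 * ‖Δ‖ ^ 2 + ℓ * n ^ 2 / (γ - 1) * e ^ 2 - ℓ * (n * e) * ‖Δ‖ := by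
        field_simp
        ring
      linarith
    have h9 : σ k i / 2 * ‖w k i - z k i‖ ^ 2 ≤ |Mu| / 2 * e ^ 2 := by
      have h10 : ‖w k i - z k i‖ ≤ e := by
        rw [norm_sub_rev]
        exact (PiLp.norm_apply_le (z k - w k) i).trans he
      have h11 : σ k i ≤ |Mu| := hσ2.trans (le_abs_self _)
      gcongr
    have h12 : γ * ℓ / 2 * ‖Δ‖ ^ 2 ≤ σ k i / 2 * ‖Δ‖ ^ 2 := by gcongr
    rw [hD]
    linarith
  have htel : P.f (W n) - P.f (W 0) = ∑ i : Fin n, (P.f (W (i + 1)) - P.f (W i)) := by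
    rw [← Finset.sum_range_sub (fun j => P.f (W j)),
      Finset.sum_range (fun j => P.f (W (j + 1)) - P.f (W j))]
  have hsum : ∑ i : Fin n, (P.f (W (i + 1)) - P.f (W i)) ≤
      ∑ i : Fin n, (D * e ^ 2 - (γ - 1) * ℓ / 4 * ‖w (k + 1) i - w k i‖ ^ 2) :=
    Finset.sum_le_sum fun i _ => by linarith [hstep i]
  rw [← htel, hW0, hWn, Finset.sum_sub_distrib, Finset.sum_const, Finset.card_univ,
    Fintype.card_fin, nsmul_eq_mul, ← Finset.mul_sum] at hsum
  have hn : ‖w (k + 1) - w k‖ ^ 2 = ∑ i, ‖w (k + 1) i - w k i‖ ^ 2 :=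
    PiLp.norm_sq_eq_of_L2 _ _
  rw [hn]
  have he2 : e ^ 2 = C ^ 2 * (ρ ^ 2) ^ k := by rw [hedef]; ring
  have : (n : ℝ) * (D * e ^ 2) = n * (D * C ^ 2) * (ρ ^ 2) ^ k := by rw [he2]; ring
  linarith

/-- A subgradient at the exact iterates, controlled by the step length and a geometric error. -/
theorem exists_subgradient (h : P.Setting εbar ρ γ ℓ Mu z σ) :
    ∃ C, 0 < C ∧ ∀ᶠ k in atTop, ∃ u : Space m,
      (∀ y ∈ P.feasProd, 0 ≤ inner ℝ (gradient P.f (P.exactIter z σ (k + 1)) - u)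
        (y - P.exactIter z σ (k + 1))) ∧
      ‖u‖ ≤ C * (‖P.exactIter z σ (k + 1) - P.exactIter z σ k‖ + ρ ^ k) := by
  obtain ⟨C, hC, H⟩ := h.exists_error_le_succ
  have hℓ := h.ℓ_pos
  set D := n * (ℓ * n + |Mu|) with hD
  refine ⟨D * (1 + C) + 1, by positivity, ?_⟩
  filter_upwards [H, h.eventually_mixed_mem] with k ⟨he, he'⟩ hmix
  set w := P.exactIter z σ with hw
  set e := C * ρ ^ k with hedef
  set a := ‖w (k + 1) - w k‖ with ha
  have hwk' : w (k + 1) ∈ P.feasProd := h.exactIter_mem k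
  -- `u` is chosen so that ∇f(w_{k+1}) - u is, blockwise, the gradient of the subproblem at its
  -- solution; its optimality condition is then the required normality.
  refine ⟨WithLp.toLp 2 fun i => P.partialGrad i (w (k + 1)) -
    (P.partialGrad i (mixed z k i) + σ k i • (w (k + 1) i - z k i)), fun y hy => ?_, ?_⟩
  · rw [PiLp.inner_apply]
    refine Finset.sum_nonneg fun i _ => ?_
    have h1 := P.exactIter_inner_nonneg (h.nonempty i) (h.convex i) (h.compact i) z σ k (hy i)
    rw [PiLp.sub_apply, PiLp.sub_apply]
    change 0 ≤ inner ℝ (P.partialGrad i (w (k + 1)) - (P.partialGrad i (w (k + 1)) -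
      (P.partialGrad i (mixed z k i) + σ k i • (w (k + 1) i - z k i)))) (y i - w (k + 1) i)
    rwa [sub_sub_cancel]
  · have hzk : ∀ l, ‖w (k + 1) l - z k l‖ ≤ a + e := fun l => by
      have h1 := PiLp.norm_apply_le (w (k + 1) - w k) l
      have h2 := (PiLp.norm_apply_le (z k - w k) l).trans he
      rw [PiLp.sub_apply] at h1 h2
      rw [norm_sub_rev] at h2
      have h3 := norm_add_le (w (k + 1) l - w k l) (w k l - z k l)
      rw [sub_add_sub_cancel] at h3
      linarith
    have ha0 : 0 ≤ a := norm_nonneg _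
    have he0 : 0 ≤ e := (norm_nonneg _).trans he
    have hblock : ∀ i, ‖P.partialGrad i (w (k + 1)) -
        (P.partialGrad i (mixed z k i) + σ k i • (w (k + 1) i - z k i))‖ ≤
        (ℓ * n + |Mu|) * (a + e) := fun i => by
      have h3 : ‖w (k + 1) - mixed z k i‖ ≤ n * (a + e) := by
        refine (norm_le_sum_norm _).trans
          ((Finset.sum_le_card_nsmul _ _ (a + e) fun l _ => ?_).trans ?_)
        · rw [PiLp.sub_apply]
          change ‖w (k + 1) l - (if l < i then z (k + 1) l else z k l)‖ ≤ a + e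
          split_ifs
          · rw [norm_sub_rev]
            have := (PiLp.norm_apply_le (z (k + 1) - w (k + 1)) l).trans he'
            rw [PiLp.sub_apply] at this
            linarith
          · exact hzk l
        · simp [mul_add]
      have h4 := h.lipschitz i _ (P.feasProd_subset_enlargedProd h.εbar_pos.le hwk') _ (hmix i)
      have h5 : ‖σ k i • (w (k + 1) i - z k i)‖ ≤ |Mu| * (a + e) := by
        rw [norm_smul, Real.norm_of_nonneg (h.σ_pos k i).le]
        exact mul_le_mul ((h.run.prox_mem k i).2.trans (le_abs_self _)) (hzk i) (norm_nonneg _)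
          (abs_nonneg _)
      rw [← sub_sub]
      have h6 := norm_sub_le (P.partialGrad i (w (k + 1)) - P.partialGrad i (mixed z k i))
        (σ k i • (w (k + 1) i - z k i))
      have h7 := mul_le_mul_of_nonneg_left h3 hℓ.le
      linarith
    refine (norm_le_sum_norm _).trans
      ((Finset.sum_le_card_nsmul _ _ _ fun i _ => hblock i).trans ?_)
    rw [Finset.card_univ, Fintype.card_fin, nsmul_eq_mul, ← mul_assoc, ← hD, hedef]
    have hρk : 0 ≤ ρ ^ k := pow_nonneg h.ρ_pos.le k
    have hD0 : 0 ≤ D := by positivity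
    nlinarith [mul_nonneg hD0 hρk, mul_nonneg hD0 (mul_nonneg hC ha0)]

end Setting

end BlockProblem

/-! ### Index shifts and comparison of rates. -/

/-- Shifting the index in a big-O bound against a geometric sequence. -/
theorem isBigO_pow_of_succ {g : ℕ → ℝ} {ρ : ℝ} (hρ : ρ ≠ 0)
    (h : (fun k => g (k + 1)) =O[atTop] fun k : ℕ => ρ ^ k) :
    g =O[atTop] fun k : ℕ => ρ ^ k := by
  have h1 := h.comp_tendsto (tendsto_sub_atTop_nat 1)
  have h2 : g =O[atTop] fun k : ℕ => ρ ^ (k - 1) := by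
    refine h1.congr' ?_ (Eventually.of_forall fun _ => rfl)
    filter_upwards [eventually_ge_atTop 1] with k hk
    simp [Nat.sub_add_cancel hk]
  refine h2.trans (IsBigO.of_bound ‖ρ⁻¹‖ ?_)
  filter_upwards [eventually_ge_atTop 1] with k hk
  obtain ⟨k, rfl⟩ : ∃ j, k = j + 1 := ⟨k - 1, by omega⟩
  rw [← norm_mul, pow_succ', inv_mul_cancel_left₀ hρ, Nat.add_sub_cancel]

/-- Shifting the index in a big-O bound against a power of the index. -/
theorem isBigO_rpow_of_succ {g : ℕ → ℝ} {r : ℝ} (hr : r ≤ 0)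
    (h : (fun k => g (k + 1)) =O[atTop] fun k : ℕ => (k : ℝ) ^ r) :
    g =O[atTop] fun k : ℕ => (k : ℝ) ^ r := by
  have h1 := h.comp_tendsto (tendsto_sub_atTop_nat 1)
  have h2 : g =O[atTop] fun k : ℕ => ((k - 1 : ℕ) : ℝ) ^ r := by
    refine h1.congr' ?_ (Eventually.of_forall fun _ => rfl)
    filter_upwards [eventually_ge_atTop 1] with k hk
    simp [Nat.sub_add_cancel hk]
  refine h2.trans (IsBigO.of_bound ((1 / 2 : ℝ) ^ r) ?_)
  filter_upwards [eventually_ge_atTop 2] with k hk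
  have hk' : (2 : ℝ) ≤ k := by exact_mod_cast hk
  rw [Real.norm_of_nonneg (by positivity), Real.norm_of_nonneg (by positivity),
    ← Real.mul_rpow (by norm_num) (by positivity)]
  refine Real.rpow_le_rpow_of_nonpos (by positivity) ?_ hr
  rw [Nat.cast_sub (by omega)]
  push_cast
  linarith

/-- A geometric sequence is dominated by every power of the index. -/
theorem isBigO_pow_rpow {ρ : ℝ} (h0 : 0 < ρ) (h1 : ρ < 1) (r : ℝ) :
    (fun k : ℕ => ρ ^ k) =O[atTop] fun k : ℕ => (k : ℝ) ^ r := by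
  have h := (isLittleO_exp_neg_mul_rpow_atTop (neg_pos.2 (Real.log_neg h0 h1)) r).isBigO
  have h2 := h.comp_tendsto tendsto_natCast_atTop_atTop
  refine h2.congr_left fun k => ?_
  simp only [Function.comp_apply, neg_neg]
  rw [mul_comm, Real.exp_nat_mul, Real.exp_log h0]

/-! ### The potential, convergence and rates. -/

namespace BlockProblem

variable {n : ℕ} {m p : Fin n → ℕ} {P : BlockProblem m p}
  {εbar ρ γ ℓ Mu : ℝ} {z : ℕ → Space m} {σ : ℕ → Fin n → ℝ}

namespace Setting

/-- The values of `f` along the exact iterates converge, and a perturbed value gap decreases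
sufficiently at every step. -/
theorem exists_potential (h : P.Setting εbar ρ γ ℓ Mu z σ) :
    ∃ Fbar D α : ℝ, 0 ≤ D ∧ 0 < α ∧
      Tendsto (fun k => P.f (P.exactIter z σ k)) atTop (𝓝 Fbar) ∧
      (∀ᶠ k in atTop, 0 < P.f (P.exactIter z σ k) - Fbar + D * (ρ ^ 2) ^ k) ∧
      ∀ᶠ k in atTop, α * (‖P.exactIter z σ (k + 1) - P.exactIter z σ k‖ + ρ ^ k) ^ 2 ≤
        (P.f (P.exactIter z σ k) - Fbar + D * (ρ ^ 2) ^ k) -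
          (P.f (P.exactIter z σ (k + 1)) - Fbar + D * (ρ ^ 2) ^ (k + 1)) := by
  obtain ⟨B, hB, H⟩ := h.exists_descent
  have hγ : 0 < γ - 1 := by linarith [h.γ_gt]
  have hρ := h.ρ_pos
  have hρ2 : 0 < 1 - ρ ^ 2 := by nlinarith [h.ρ_lt]
  set α := (γ - 1) * ℓ / 4 with hα
  have hα0 : 0 < α := by have := h.ℓ_pos; positivity
  -- Then D ρ^{2k} - D ρ^{2(k+1)} = (B + α) ρ^{2k}: it pays the descent error and leaves α ρ^{2k}
  -- for the ρ^k part of the perturbed step.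
  set D := (B + α) / (1 - ρ ^ 2) with hD
  have hD0 : 0 ≤ D := by positivity
  have hDe : D * (1 - ρ ^ 2) = B + α := div_mul_cancel₀ _ hρ2.ne'
  set w := P.exactIter z σ with hw
  set V : ℕ → ℝ := fun k => P.f (w k) + D * (ρ ^ 2) ^ k with hV
  have hstep : ∀ᶠ k in atTop, α * ‖w (k + 1) - w k‖ ^ 2 + α * (ρ ^ 2) ^ k ≤ V k - V (k + 1) := by
    filter_upwards [H] with k hk
    have e : V k - V (k + 1) = P.f (w k) - P.f (w (k + 1)) + D * (1 - ρ ^ 2) * (ρ ^ 2) ^ k := by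
      simp only [hV, pow_succ]; ring
    rw [e, hDe]
    linarith
  have hcomp := P.isCompact_feasProd h.compact
  obtain ⟨b, hb⟩ := hcomp.bddBelow_image P.f_differentiable.continuous.continuousOn
  obtain ⟨K, hK⟩ := eventually_atTop.1 hstep
  have hpow : ∀ k : ℕ, 0 < (ρ ^ 2) ^ k := fun k => by positivity
  have hanti : Antitone fun k => V (k + (K + 1)) := antitone_nat_of_succ_le fun k => by
    have h1 := hK (k + (K + 1)) (by omega)
    have h2 := mul_pos hα0 (hpow (k + (K + 1)))
    have h3 : 0 ≤ α * ‖w (k + (K + 1) + 1) - w (k + (K + 1))‖ ^ 2 := by positivity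
    rw [show k + 1 + (K + 1) = k + (K + 1) + 1 by omega]
    linarith
  have hbdd : BddBelow (Set.range fun k => V (k + (K + 1))) := by
    refine ⟨b, ?_⟩
    rintro _ ⟨k, rfl⟩
    have h1 : b ≤ P.f (w (k + K + 1)) := hb ⟨_, h.exactIter_mem (k + K), rfl⟩
    have h2 := mul_nonneg hD0 (hpow (k + K + 1)).le
    change b ≤ P.f (w (k + K + 1)) + D * (ρ ^ 2) ^ (k + K + 1)
    linarith
  set Fbar := ⨅ k, V (k + (K + 1)) with hF
  have hVlim : Tendsto V atTop (𝓝 Fbar) :=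
    (tendsto_add_atTop_iff_nat (K + 1)).1 (tendsto_atTop_ciInf hanti hbdd)
  have hDlim : Tendsto (fun k : ℕ => D * (ρ ^ 2) ^ k) atTop (𝓝 0) := by
    simpa using (tendsto_pow_atTop_nhds_zero_of_lt_one (by positivity)
      (by linarith : ρ ^ 2 < 1)).const_mul D
  refine ⟨Fbar, D, α / 2, hD0, by positivity, ?_, ?_, ?_⟩
  · simpa [hV] using hVlim.sub hDlim
  · filter_upwards [eventually_ge_atTop (K + 1)] with k hk
    -- Strict positivity comes from the next index: V k exceeds V (k + 1), which is at least the
    -- limit.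
    have h1 : Fbar ≤ V (k + 1) := by
      have := ciInf_le hbdd (k + 1 - (K + 1))
      rwa [show k + 1 - (K + 1) + (K + 1) = k + 1 by omega] at this
    have h2 := hK k (by omega)
    have h3 := mul_pos hα0 (hpow k)
    have h4 : 0 ≤ α * ‖w (k + 1) - w k‖ ^ 2 := by positivity
    have h5 : V k = P.f (w k) + D * (ρ ^ 2) ^ k := rfl
    linarith
  · filter_upwards [hstep] with k hk
    have h1 : α / 2 * (‖w (k + 1) - w k‖ + ρ ^ k) ^ 2 ≤
        α * ‖w (k + 1) - w k‖ ^ 2 + α * (ρ ^ 2) ^ k := by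
      have e : (ρ ^ 2) ^ k = (ρ ^ k) ^ 2 := by ring
      rw [e]
      nlinarith [mul_nonneg hα0.le (sq_nonneg (‖w (k + 1) - w k‖ - ρ ^ k))]
    refine (h1.trans hk).trans (le_of_eq ?_)
    simp only [hV]
    ring

/-- The gradient of `f` is Lipschitz on the feasible product. -/
theorem gradient_lipschitz (h : P.Setting εbar ρ γ ℓ Mu z σ) {x y : Space m}
    (hx : x ∈ P.feasProd) (hy : y ∈ P.feasProd) :
    ‖gradient P.f x - gradient P.f y‖ ≤ n * ℓ * ‖x - y‖ := by
  refine (norm_le_sum_norm _).trans ((Finset.sum_le_card_nsmul _ _ _ fun i _ =>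
    h.lipschitz_feasProd i x hx y hy).trans (le_of_eq ?_))
  rw [Finset.card_univ, Fintype.card_fin, nsmul_eq_mul, mul_assoc]

/-- The exact iterates have a feasible stationary cluster point. -/
theorem exists_stationary_clusterPt (h : P.Setting εbar ρ γ ℓ Mu z σ) :
    ∃ x ∈ P.feasProd, MapClusterPt x atTop (P.exactIter z σ) ∧ IsStationaryPt P.F x := by
  set w := P.exactIter z σ with hw
  obtain ⟨x, hx, ψ, hψ, hlim⟩ := (P.isCompact_feasProd h.compact).tendsto_subseq
    (x := fun k => w (k + 1)) h.exactIter_mem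
  refine ⟨x, hx, hlim.mapClusterPt.of_comp ((tendsto_add_atTop_nat 1).comp hψ.tendsto_atTop), ?_⟩
  obtain ⟨Fbar, D, α, hD, hα, hf, -, hdec⟩ := h.exists_potential
  obtain ⟨C, hC, hsub⟩ := h.exists_subgradient
  obtain ⟨u, hu⟩ := hsub.choice
  rw [← hw] at hf hdec hu
  set b : ℕ → ℝ := fun k => ‖w (k + 1) - w k‖ + ρ ^ k with hb
  set R : ℕ → ℝ := fun k => P.f (w k) - Fbar + D * (ρ ^ 2) ^ k with hR
  have hRlim : Tendsto R atTop (𝓝 0) := by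
    have h1 := (tendsto_pow_atTop_nhds_zero_of_lt_one (by positivity)
      (by nlinarith [h.ρ_pos, h.ρ_lt] : ρ ^ 2 < 1)).const_mul D
    simpa using (hf.sub_const Fbar).add h1
  have hb2 : Tendsto (fun k => b k ^ 2) atTop (𝓝 0) := by
    have h1 : Tendsto (fun k => (R k - R (k + 1)) / α) atTop (𝓝 0) := by
      simpa using (hRlim.sub (hRlim.comp (tendsto_add_atTop_nat 1))).div_const α
    refine squeeze_zero' (Eventually.of_forall fun _ => sq_nonneg _) ?_ h1
    filter_upwards [hdec] with k hk
    rw [le_div_iff₀ hα]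
    linarith
  have hblim : Tendsto b atTop (𝓝 0) := by
    have h1 := hb2.sqrt
    rw [Real.sqrt_zero] at h1
    refine h1.congr fun k => Real.sqrt_sq ?_
    exact add_nonneg (norm_nonneg _) (pow_nonneg h.ρ_pos.le k)
  have hulim : Tendsto u atTop (𝓝 0) := by
    have h1 : Tendsto (fun k => C * b k) atTop (𝓝 0) := by simpa using hblim.const_mul C
    exact squeeze_zero_norm' (hu.mono fun k hk => hk.2) h1
  -- `f` is only assumed differentiable; continuity of its gradient comes from the Lipschitz bound
  -- on the feasible product.
  have hglim : Tendsto (fun j => gradient P.f (w (ψ j + 1))) atTop (𝓝 (gradient P.f x)) := by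
    rw [tendsto_iff_norm_sub_tendsto_zero] at hlim ⊢
    have h1 : Tendsto (fun j => n * ℓ * ‖w (ψ j + 1) - x‖) atTop (𝓝 0) := by
      simpa using hlim.const_mul (n * ℓ)
    exact squeeze_zero (fun _ => norm_nonneg _)
      (fun j => h.gradient_lipschitz (h.exactIter_mem _) hx) h1
  refine P.mem_frechetSubdiff_F hx fun y hy => ?_
  have h1 : Tendsto (fun j => inner ℝ (gradient P.f (w (ψ j + 1)) - u (ψ j)) (y - w (ψ j + 1)))
      atTop (𝓝 (inner ℝ (gradient P.f x - 0) (y - x))) :=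
    (hglim.sub (hulim.comp hψ.tendsto_atTop)).inner (tendsto_const_nhds.sub hlim)
  exact ge_of_tendsto h1 ((hψ.tendsto_atTop.eventually hu).mono fun j hj => hj.1 y hy)

/-- Convergence of the exact iterates to a cluster point with the Łojasiewicz property, together
with the recursion that governs the rate. -/
theorem tendsto_exactIter (h : P.Setting εbar ρ γ ℓ Mu z σ) {x : Space m} (hx : x ∈ P.feasProd)
    (hcl : MapClusterPt x atTop (P.exactIter z σ)) {θ : ℝ}
    (hθ : IsLojasiewiczExponent P.F x θ) :
    Tendsto (P.exactIter z σ) atTop (𝓝 x) ∧ ∃ R : ℕ → ℝ, ∃ C M : ℝ, 0 < C ∧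
      (∀ᶠ k in atTop, 0 < R k) ∧ Tendsto R atTop (𝓝 0) ∧
      (∀ᶠ k in atTop, ‖P.exactIter z σ (k + 1) - x‖ ≤ M * R k ^ (1 - max θ (1 / 2))) ∧
      ∀ᶠ k in atTop, R (k + 1) ^ (2 * max θ (1 / 2)) ≤ C * (R k - R (k + 1)) := by
  obtain ⟨Fbar, D, α, hD, hα, hf, hpos, hdec⟩ := h.exists_potential
  obtain ⟨C, hC, hsub⟩ := h.exists_subgradient
  set w := P.exactIter z σ with hw
  set b : ℕ → ℝ := fun k => ‖w (k + 1) - w k‖ + ρ ^ k with hb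
  set R : ℕ → ℝ := fun k => P.f (w k) - Fbar + D * (ρ ^ 2) ^ k with hR
  have hρ := h.ρ_pos
  have hRlim : Tendsto R atTop (𝓝 0) := by
    have h1 := (tendsto_pow_atTop_nhds_zero_of_lt_one (by positivity)
      (by nlinarith [h.ρ_lt] : ρ ^ 2 < 1)).const_mul D
    simpa using (hf.sub_const Fbar).add h1
  -- A convergent sequence has no cluster value other than its limit.
  have hfx : P.f x = Fbar := by
    have h1 : MapClusterPt (P.f x) atTop (fun k => P.f (w k)) :=
      hcl.tendsto_comp (P.f_differentiable.continuous.tendsto x)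
    by_contra hne
    exact (ClusterPt.mono h1 hf).ne (disjoint_nhds_nhds.2 hne).eq_bot
  set ϑ := max θ (1 / 2) with hϑ
  have hϑ0 : 1 / 2 ≤ ϑ := le_max_right _ _
  have hϑ1 : ϑ < 1 := max_lt hθ.2.1 (by norm_num)
  obtain ⟨c, hc, η, hη, hloj⟩ := hθ.rpow_le (P.F_of_mem hx)
  rw [hfx] at hloj
  have hkl : ∀ᶠ k in atTop, dist (w (k + 1)) x ≤ η → R (k + 1) ^ ϑ ≤ (c * C + D ^ ϑ) * b k := by
    have h1 : ∀ᶠ k in atTop, |P.f (w (k + 1)) - Fbar| ≤ 1 := by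
      have h2 : Tendsto (fun k => |P.f (w (k + 1)) - Fbar|) atTop (𝓝 0) := by
        simpa using ((hf.comp (tendsto_add_atTop_nat 1)).sub_const Fbar).abs
      exact h2.eventually (ge_mem_nhds zero_lt_one)
    filter_upwards [h1, hsub, (tendsto_add_atTop_nat 1).eventually hpos] with k h1 ⟨u, hu, hub⟩ hp hd
    have h3 := hloj (w (k + 1)) u _ hd (P.F_of_mem (h.exactIter_mem k)) h1
      (P.mem_frechetSubdiff_F (h.exactIter_mem k) hu)
    have h4 : R (k + 1) ≤ |P.f (w (k + 1)) - Fbar| + D * (ρ ^ 2) ^ (k + 1) := by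
      have := le_abs_self (P.f (w (k + 1)) - Fbar)
      simp only [hR]
      linarith
    have hDp : 0 ≤ D * (ρ ^ 2) ^ (k + 1) := by positivity
    -- Because ϑ ≥ 1/2, the ϑ-th power of the squared perturbation is at most of order ρ^k, which `b
    -- k` contains.
    have h5 : (D * (ρ ^ 2) ^ (k + 1)) ^ ϑ ≤ D ^ ϑ * b k := by
      rw [Real.mul_rpow hD (by positivity)]
      refine mul_le_mul_of_nonneg_left ?_ (by positivity)
      have h6 : ((ρ ^ 2) ^ (k + 1)) ^ ϑ ≤ ((ρ ^ 2) ^ (k + 1)) ^ (1 / 2 : ℝ) :=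
        Real.rpow_le_rpow_of_exponent_ge (by positivity)
          (pow_le_one₀ (by positivity) (pow_le_one₀ hρ.le h.ρ_lt.le)) hϑ0
      have e : (ρ ^ 2) ^ (k + 1) = (ρ ^ (k + 1)) ^ 2 := by ring
      rw [← Real.sqrt_eq_rpow, e, Real.sqrt_sq (by positivity)] at h6
      rw [e]
      refine h6.trans ((pow_le_pow_of_le_one hρ.le h.ρ_lt.le (Nat.le_succ k)).trans ?_)
      simp only [hb]
      linarith [norm_nonneg (w (k + 1) - w k)]
    calc R (k + 1) ^ ϑ ≤ (|P.f (w (k + 1)) - Fbar| + D * (ρ ^ 2) ^ (k + 1)) ^ ϑ :=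
          Real.rpow_le_rpow hp.le h4 (by linarith)
      _ ≤ |P.f (w (k + 1)) - Fbar| ^ ϑ + (D * (ρ ^ 2) ^ (k + 1)) ^ ϑ :=
          Real.rpow_add_le_add_rpow (abs_nonneg _) hDp (by linarith) hϑ1.le
      _ ≤ c * (C * b k) + D ^ ϑ * b k :=
          add_le_add (h3.trans (mul_le_mul_of_nonneg_left hub hc.le)) h5
      _ = _ := by ring
  have hC' : 0 < c * C + D ^ ϑ := by positivity
  obtain ⟨h1, ⟨M, h2⟩, h3⟩ := tendsto_of_kl (w := w) (R := R) (b := b) hα hC' hϑ0 hϑ1 hη hpos hRlim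
    (Eventually.of_forall fun k => by
      rw [dist_comm, dist_eq_norm]
      simp only [hb]
      linarith [pow_pos hρ k]) hdec hcl hkl
  refine ⟨h1, R, _, M, by positivity, hpos, hRlim, ?_, h3⟩
  simpa only [dist_eq_norm] using h2

theorem error_isBigO (h : P.Setting εbar ρ γ ℓ Mu z σ) :
    (fun k => ‖z k - P.exactIter z σ k‖) =O[atTop] fun k : ℕ => ρ ^ k := by
  obtain ⟨C, -, H⟩ := h.exists_error_le
  refine IsBigO.of_bound C ?_
  filter_upwards [H] with k hk
  rwa [norm_norm, Real.norm_of_nonneg (pow_nonneg h.ρ_pos.le k)]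

theorem tendsto_error (h : P.Setting εbar ρ γ ℓ Mu z σ) :
    Tendsto (fun k => z k - P.exactIter z σ k) atTop (𝓝 0) :=
  tendsto_zero_iff_norm_tendsto_zero.2
    (h.error_isBigO.trans_tendsto (tendsto_pow_atTop_nhds_zero_of_lt_one h.ρ_pos.le h.ρ_lt))

theorem norm_sub_isBigO {r : ℕ → ℝ} {x : Space m}
    (h1 : (fun k => ‖z k - P.exactIter z σ k‖) =O[atTop] r)
    (h2 : (fun k => ‖P.exactIter z σ k - x‖) =O[atTop] r) :
    (fun k => ‖z k - x‖) =O[atTop] r := by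
  refine IsBigO.norm_left ((h1.of_norm_left.add h2.of_norm_left).congr_left fun k => ?_)
  abel

/-- Linear convergence when the Łojasiewicz exponent is at most `1/2`. -/
theorem linear_rate (h : P.Setting εbar ρ γ ℓ Mu z σ) {x : Space m} (hx : x ∈ P.feasProd)
    (hcl : MapClusterPt x atTop (P.exactIter z σ)) {θ : ℝ}
    (hθ : IsLojasiewiczExponent P.F x θ) (hle : θ ≤ 1 / 2) :
    ∃ q ∈ Set.Ioo (0 : ℝ) 1, (fun k => ‖z k - x‖) =O[atTop] fun k : ℕ => q ^ k := by
  obtain ⟨-, R, C, M, hC, hpos, -, hd, hrec⟩ := h.tendsto_exactIter hx hcl hθ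
  rw [max_eq_right hle] at hd hrec
  simp only [show (1 : ℝ) - 1 / 2 = 1 / 2 by norm_num] at hd
  simp only [show (2 : ℝ) * (1 / 2) = 1 by norm_num, Real.rpow_one] at hrec
  obtain ⟨q, hq, hRq⟩ := isBigO_geometric_of_le hC hpos hrec
  have hs0 : 0 < √q := Real.sqrt_pos.2 hq.1
  have hs1 : √q < 1 := by rw [Real.sqrt_lt' one_pos]; simpa using hq.2
  have h1 : (fun k => ‖P.exactIter z σ k - x‖) =O[atTop] fun k : ℕ => (√q) ^ k := by
    refine isBigO_pow_of_succ (g := fun k => ‖P.exactIter z σ k - x‖) hs0.ne' ?_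
    have h2 : (fun k => ‖P.exactIter z σ (k + 1) - x‖) =O[atTop] fun k => R k ^ (1 / 2 : ℝ) := by
      refine IsBigO.of_bound M ?_
      filter_upwards [hd, hpos] with k hk hp
      rwa [norm_norm, Real.norm_of_nonneg (Real.rpow_nonneg hp.le _)]
    refine h2.trans ((hRq.rpow (by norm_num) (Eventually.of_forall fun k =>
      pow_nonneg hq.1.le k)).congr_right fun k => ?_)
    rw [← Real.sqrt_eq_rpow, Real.sqrt_eq_iff_mul_self_eq (pow_nonneg hq.1.le k) (by positivity),
      ← mul_pow, Real.mul_self_sqrt hq.1.le]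
  have hmono : ∀ {a b : ℝ}, 0 ≤ a → a ≤ b →
      (fun k : ℕ => a ^ k) =O[atTop] fun k : ℕ => b ^ k := fun {a b} ha hab =>
    IsBigO.of_bound 1 (Eventually.of_forall fun k => by
      rw [one_mul, Real.norm_of_nonneg (pow_nonneg ha k),
        Real.norm_of_nonneg (pow_nonneg (ha.trans hab) k)]
      exact pow_le_pow_left₀ ha hab k)
  -- The rate is the slower of the inexactness ρ and the rate √q of the exact iterates, whose
  -- distance is controlled by the square root of `R`.
  exact ⟨max ρ (√q), ⟨lt_max_of_lt_left h.ρ_pos, max_lt h.ρ_lt hs1⟩,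
    norm_sub_isBigO (h.error_isBigO.trans (hmono h.ρ_pos.le (le_max_left _ _)))
      (h1.trans (hmono hs0.le (le_max_right _ _)))⟩

/-- Sublinear convergence when the Łojasiewicz exponent exceeds `1/2`. -/
theorem sublinear_rate (h : P.Setting εbar ρ γ ℓ Mu z σ) {x : Space m} (hx : x ∈ P.feasProd)
    (hcl : MapClusterPt x atTop (P.exactIter z σ)) {θ : ℝ}
    (hθ : IsLojasiewiczExponent P.F x θ) (hlt : 1 / 2 < θ) :
    (fun k => ‖z k - x‖) =O[atTop] fun k : ℕ => (k : ℝ) ^ (-((1 - θ) / (2 * θ - 1))) := by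
  obtain ⟨-, R, C, M, hC, hpos, hR0, hd, hrec⟩ := h.tendsto_exactIter hx hcl hθ
  rw [max_eq_left hlt.le] at hd hrec
  have hθ1 := hθ.2.1
  have hs : 0 < 2 * θ - 1 := by linarith
  -- With 2θ = 1 + s the potential decays like k^{-1/s}; its power 1 - θ gives the stated exponent,
  -- and the geometric error is negligible.
  have hRq := isBigO_rpow_of_le (s := 2 * θ - 1) hC hs (by linarith) hpos hR0
    (by rwa [add_sub_cancel])
  refine norm_sub_isBigO (h.error_isBigO.trans (isBigO_pow_rpow h.ρ_pos h.ρ_lt _)) ?_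
  refine isBigO_rpow_of_succ (g := fun k => ‖P.exactIter z σ k - x‖)
    (neg_nonpos.2 (div_nonneg (by linarith) hs.le)) ?_
  have h2 : (fun k => ‖P.exactIter z σ (k + 1) - x‖) =O[atTop] fun k => R k ^ (1 - θ) := by
    refine IsBigO.of_bound M ?_
    filter_upwards [hd, hpos] with k hk hp
    rwa [norm_norm, Real.norm_of_nonneg (Real.rpow_nonneg hp.le _)]
  refine h2.trans ((hRq.rpow (by linarith) (Eventually.of_forall fun k =>
    Real.rpow_nonneg (Nat.cast_nonneg k) _)).congr_right fun k => ?_)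
  rw [← Real.rpow_mul (Nat.cast_nonneg k)]
  congr 1
  ring

/-- The weighted squared errors are summable. -/
theorem summable_errTerm (h : P.Setting εbar ρ γ ℓ Mu z σ) (L : ℝ) :
    Summable (P.errTerm L γ z σ) := by
  have hb : ∀ k, |⨆ i, σ k i| ≤ |Mu| := fun k => by
    rw [abs_of_nonneg (Real.iSup_nonneg fun i => (h.σ_pos k i).le)]
    exact Real.iSup_le (fun i => (h.run.prox_mem k i).2.trans (le_abs_self _)) (abs_nonneg _)
  have h1 : (fun k => constC1 n L γ (⨆ i, σ k i)) =O[atTop] fun _ : ℕ => (1 : ℝ) := by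
    refine IsBigO.of_bound ((|Mu| + |L * (12 / (γ - 1) / 2 * (n : ℝ) ^ 2 +
      (2 + 2 / (12 / (γ - 1)) - 12 / (γ - 1) / 2) * n + 2 * (12 / (γ - 1)) +
        4 / (12 / (γ - 1)) + 3)|) / 2) (Eventually.of_forall fun k => ?_)
    rw [norm_one, mul_one, constC1, Real.norm_eq_abs, abs_div, abs_two]
    gcongr
    exact (abs_add_le _ _).trans (add_le_add_left (hb k) _)
  have h2 : (fun k => ‖P.exactIter z σ k - z k‖) =O[atTop] fun k : ℕ => ρ ^ k :=
    h.error_isBigO.congr_left fun k => norm_sub_rev _ _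
  have h3 : P.errTerm L γ z σ =O[atTop] fun k : ℕ => (ρ ^ 2) ^ k :=
    (h1.mul (h2.pow 2)).congr_right fun k => by ring
  exact summable_of_isBigO_nat (summable_geometric_of_lt_one (sq_nonneg ρ)
    (by nlinarith [h.ρ_pos, h.ρ_lt])) h3

end Setting

/-- The tails of the error series vanish, so the surrogate values follow the values of `f`. -/
theorem tendsto_surrogate (L : ℝ) {Fbar : ℝ}
    (hmem : ∀ k, P.exactIter z σ (k + 1) ∈ P.feasProd)
    (hf : Tendsto (fun k => P.f (P.exactIter z σ k)) atTop (𝓝 Fbar)) :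
    Tendsto (P.surrogate L γ z σ) atTop (𝓝 (Fbar : EReal)) := by
  have h1 : Tendsto (P.errTail L γ z σ) atTop (𝓝 0) := by
    refine (tendsto_sum_nat_add (P.errTerm L γ z σ)).congr fun k => ?_
    simp only [errTail, add_comm]
  have h2 : Tendsto (fun k => P.f (P.exactIter z σ k) +
      (P.errTail L γ z σ k + P.errTail L γ z σ (k + 1))) atTop (𝓝 Fbar) := by
    simpa using hf.add (h1.add (h1.comp (tendsto_add_atTop_nat 1)))
  refine ((continuous_coe_real_ereal.tendsto Fbar).comp h2).congr' ?_
  filter_upwards [eventually_ge_atTop 1] with k hk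
  obtain ⟨k, rfl⟩ : ∃ j, k = j + 1 := ⟨k - 1, by omega⟩
  rw [Function.comp_apply, surrogate, P.F_of_mem (hmem k), EReal.coe_add]

end BlockProblem

end PALMI

/-! ### Assembly of the theorem. -/

open PALMI
theorem mainTheorem2 {n : ℕ} {m p : Fin n → ℕ} (P : BlockProblem m p)
    (εbar ρt γ L Mu : ℝ) (Lip : Fin n → ℝ)
    (hε : 0 < εbar) (hρ : ρt ∈ Set.Ioo (0 : ℝ) 1) (hγ : 1 < γ)
    (hLip : P.LipschitzBlocks εbar Lip)
    (hL : L = ⨆ i, Lip i)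
    (hMu : γ * L ≤ Mu)
    (hcon : P.ConstraintAssumption εbar (γ * L))
    (hKL : ∀ x, IsStationaryPt P.F x → HasLojasiewicz P.F x)
    (z : ℕ → Space m) (σ : ℕ → Fin n → ℝ)
    (hrun : P.IsRun (fun k => εbar * ρt ^ k) (γ * L) Mu z σ) :
    ∃ (zbar : Space m) (Fbar : ℝ),
      Tendsto z atTop (𝓝 zbar) ∧ IsStationaryPt P.F zbar ∧
      Summable (P.errTerm L γ z σ) ∧
      Tendsto (P.surrogate L γ z σ) atTop (𝓝 (Fbar : EReal)) ∧
      ((∀ k, 1 ≤ k → (Fbar : EReal) < P.surrogate L γ z σ k) →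
        ∀ θ : ℝ, IsLojasiewiczExponent P.F zbar θ →
          (θ = 0 → ∃ ρ₁ ∈ Set.Ioo (0 : ℝ) 1,
            (fun k => ‖z k - zbar‖) =O[atTop] (fun k : ℕ => ρ₁ ^ k)) ∧
          (0 < θ ∧ θ ≤ 1 / 2 → ∃ ρ₂ ∈ Set.Ioo (0 : ℝ) 1,
            (fun k => ‖z k - zbar‖) =O[atTop] (fun k : ℕ => ρ₂ ^ k)) ∧
          (1 / 2 < θ ∧ θ < 1 →
            (fun k => ‖z k - zbar‖) =O[atTop]
              (fun k : ℕ => (k : ℝ) ^ (-((1 - θ) / (2 * θ - 1)))))) := by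
  have hbdd : BddAbove (Set.range Lip) := (Set.finite_range Lip).bddAbove
  -- With no blocks the supremum `L` over the empty family is 0, while `Setting` needs a positive
  -- modulus; then ℓ = 1 serves, all blockwise conditions being vacuous.
  obtain ⟨ℓ, hℓ, hLipℓ, hℓL⟩ : ∃ ℓ : ℝ, 0 < ℓ ∧ (∀ i, Lip i ≤ ℓ) ∧ (∀ _ : Fin n, ℓ = L) := by
    rcases isEmpty_or_nonempty (Fin n) with hn | ⟨⟨i⟩⟩
    · exact ⟨1, one_pos, fun i => hn.elim i, fun i => hn.elim i⟩
    · have h1 : ∀ i, Lip i ≤ L := fun i => hL ▸ le_ciSup hbdd i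
      exact ⟨L, (hLip i).1.trans_le (h1 i), h1, fun _ => rfl⟩
  have h : P.Setting εbar ρt γ ℓ Mu z σ :=
    { εbar_pos := hε
      ρ_pos := hρ.1
      ρ_lt := hρ.2
      γ_gt := hγ
      ℓ_pos := hℓ
      lipschitz := fun i z₁ h₁ z₂ h₂ => ((hLip i).2 z₁ h₁ z₂ h₂).trans
        (mul_le_mul_of_nonneg_right (hLipℓ i) (norm_nonneg _))
      nonempty := fun i => (hcon i).1
      convex := fun i => (hcon i).2.1
      compact := fun i => (hcon i).2.2.1
      hoffman := fun i => hℓL i ▸ (hcon i).2.2.2.2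
      run := ⟨fun k i => hℓL i ▸ hrun.prox_mem k i, hrun.inexact⟩ }
  obtain ⟨x, hx, hcl, hstat⟩ := h.exists_stationary_clusterPt
  -- Any exponent at the cluster point suffices for convergence; the rates are then derived again
  -- with the prescribed θ at the same point.
  obtain ⟨θ₀, hθ₀⟩ := hKL x hstat
  have hw := (h.tendsto_exactIter hx hcl hθ₀).1
  refine ⟨x, P.f x, ?_, hstat, h.summable_errTerm L, ?_, fun _ θ hθ => ⟨fun h0 => ?_, fun h1 => ?_,
    fun h2 => h.sublinear_rate hx hcl hθ h2.1⟩⟩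
  · simpa using h.tendsto_error.add hw
  · exact BlockProblem.tendsto_surrogate L h.exactIter_mem
      ((P.f_differentiable.continuous.tendsto x).comp hw)
  · exact h.linear_rate hx hcl hθ (by rw [h0]; norm_num)
  · exact h.linear_rate hx hcl hθ h1.2
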